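/- **Theorem 3.1.** For a (real-valued) tempered distribution $\mu\in\mathcal S'(\mathbb R^d)$ or a continuous function $\mu$ of polynomial growth, let $$H[\mu](x,t)=(4\pi t)^{-d/2}\Big\langle \mu,\ e^{-|x-\cdot|^2/(4t)}\Big\rangle ,\qquad x\in\mathbb R^d,\ t>0,$$ be its heat extension; for a continuous function $G$ put also $H[G](x,0)=G(x)$. For a non-negative function $w$ let $\|f\|_{L_p(w)}=\big(\int_{\mathbb R^d}|f(x)|^p\,w(x)\,dx\big)^{1/p}$. A set $\mathbb M\subset\mathcal S'(\mathbb R^d)$ is called an *invariant cone of measures* if every $\mu\in\mathbb M$ is a measure, i.e. a non-negative distribution; $\mathbb M$ is closed in $\mathcal S'(\mathbb R^d)$ (with the strong dual topology); $\mathbb M$ is invariant under all dilations $x\mapsto rx$, $r>0$, and under all translations; and $c\mu\in\mathbb M$ whenever $\mu\in\mathbb M$ and $c\ge 0$. Let $\mathbb M$ be an invariant cone of measures that does not contain the Dirac measure $\delta_0$, let $p\in(1,\infty)$, and let $C_G,\theta_G$ be real constants. Then there exists $\delta>0$, depending only on $\mathbb M$, $p$, $C_G$ and $\theta_G$, such that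 for every continuous positive function $G\colon\mathbb R^d\to(0,\infty)$ with $$\sup\Big\{\frac{G(x)}{G(y)}\ :\ x,y\in\mathbb R^d,\ |x-y|\le\zeta\Big\}\le C_G(1+|\zeta|)^{\theta_G}\qquad\text{for all }\zeta\ge 0,$$ and for every $\mu\in\mathbb M$ with $\|H[\mu](\cdot,1)\|_{L_p(G)}<\infty$, one has $$\big\|H[\mu](\cdot,t)\big\|_{L_p\left(H[G](\cdot,\frac{1-t}{p})\right)}\le t^{-\frac d2\,\frac{p-1}{p}+\delta}\,\big\|H[\mu](\cdot,1)\big\|_{L_p(G)}\qquad\text{for all }t\in(0,1].$$ -/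

import Mathlib

open MeasureTheory
open scoped SchwartzMap ENNReal

/-- The bound behind the fact that Gaussians are Schwartz functions. -/
theorem one_add_pow_mul_exp_neg_sq_le (b : ℝ) (hb : 0 < b) (N : ℕ) :
    ∃ C : ℝ, ∀ r : ℝ, 0 ≤ r → (1 + r) ^ N * Real.exp (-b * r ^ 2) ≤ C := by
  refine ⟨2 ^ N * (N.factorial * Real.exp b / b ^ N), fun r hr => ?_⟩
  have h1 : 1 + r ≤ 2 * (1 + r ^ 2) := by nlinarith [sq_nonneg (r - 1)]
  have h2 : (1 + r) ^ N ≤ 2 ^ N * (1 + r ^ 2) ^ N := by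
    rw [← mul_pow]
    gcongr
  have h3 := Real.pow_div_factorial_le_exp (b * (1 + r ^ 2)) (by positivity) N
  have hf : (0 : ℝ) < N.factorial := by exact_mod_cast N.factorial_pos
  rw [div_le_iff₀ hf, mul_pow] at h3
  have h4 : (1 + r ^ 2) ^ N ≤ N.factorial * Real.exp b / b ^ N * Real.exp (b * r ^ 2) := by
    rw [div_mul_eq_mul_div, le_div_iff₀ (by positivity), mul_assoc, ← Real.exp_add]
    have : b + b * r ^ 2 = b * (1 + r ^ 2) := by ring
    rw [this]
    linarith
  calc (1 + r) ^ N * Real.exp (-b * r ^ 2)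
      ≤ (2 ^ N * (N.factorial * Real.exp b / b ^ N * Real.exp (b * r ^ 2)))
          * Real.exp (-b * r ^ 2) := by
        gcongr
        exact h2.trans (by gcongr)
    _ = 2 ^ N * (N.factorial * Real.exp b / b ^ N)
          * (Real.exp (b * r ^ 2) * Real.exp (-b * r ^ 2)) := by ring
    _ = 2 ^ N * (N.factorial * Real.exp b / b ^ N) := by
        rw [← Real.exp_add]
        simp

/-- All derivatives of a Gaussian decay faster than any power. -/
theorem gaussian_decay {d : ℕ} (b : ℝ) (hb : 0 < b) (k n : ℕ) :
    ∃ C : ℝ, ∀ z : EuclideanSpace ℝ (Fin d),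
      ‖z‖ ^ k * ‖iteratedFDeriv ℝ n (fun z => Real.exp (-b * ‖z‖ ^ 2)) z‖ ≤ C := by
  have hg : (fun z : EuclideanSpace ℝ (Fin d) => -b * ‖z‖ ^ 2).HasTemperateGrowth := by
    fun_prop
  obtain ⟨m, C, hC, hbd⟩ := hg.norm_iteratedFDeriv_le_uniform n
  obtain ⟨K, hK⟩ := one_add_pow_mul_exp_neg_sq_le b hb (k + m * n)
  refine ⟨n.factorial * (C + 1) ^ n * K, fun z => ?_⟩
  have hD : 1 ≤ (C + 1) * (1 + ‖z‖) ^ m := by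
    have : (1 : ℝ) ≤ (1 + ‖z‖) ^ m := one_le_pow₀ (by linarith [norm_nonneg z])
    nlinarith
  have hcomp := norm_iteratedFDeriv_comp_le (𝕜 := ℝ) (g := Real.exp)
    (f := fun z : EuclideanSpace ℝ (Fin d) => -b * ‖z‖ ^ 2) (n := n) (N := ((n : ℕ∞) : WithTop ℕ∞))
    Real.contDiff_exp (hg.1.of_le (by exact_mod_cast le_top)) (by simp) z
    (C := Real.exp (-b * ‖z‖ ^ 2)) (D := (C + 1) * (1 + ‖z‖) ^ m)
    (fun i _ => by
      rw [norm_iteratedFDeriv_eq_norm_iteratedDeriv, iteratedDeriv_eq_iterate, Real.iter_deriv_exp,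
        Real.norm_eq_abs, abs_of_pos (Real.exp_pos _)])
    (fun i hi hin => by
      refine (hbd i hin z).trans ?_
      calc C * (1 + ‖z‖) ^ m ≤ (C + 1) * (1 + ‖z‖) ^ m := by gcongr; linarith
        _ ≤ _ := le_self_pow₀ hD (by omega))
  have hz : ‖z‖ ^ k ≤ (1 + ‖z‖) ^ k := by gcongr; linarith
  calc ‖z‖ ^ k * ‖iteratedFDeriv ℝ n (fun z => Real.exp (-b * ‖z‖ ^ 2)) z‖
      ≤ (1 + ‖z‖) ^ k * (n.factorial * Real.exp (-b * ‖z‖ ^ 2)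
          * ((C + 1) * (1 + ‖z‖) ^ m) ^ n) := by
        gcongr
        exact hcomp
    _ = n.factorial * (C + 1) ^ n * ((1 + ‖z‖) ^ (k + m * n) * Real.exp (-b * ‖z‖ ^ 2)) := by
        rw [mul_pow, pow_add, pow_mul]
        ring
    _ ≤ n.factorial * (C + 1) ^ n * K := by
        gcongr
        exact hK _ (norm_nonneg z)

/-- The Gaussian `z ↦ exp(-b|z|²)`, `b > 0`, as a Schwartz function. -/
noncomputable def schwartzGaussian (d : ℕ) (b : ℝ) (hb : 0 < b) :
    𝓢(EuclideanSpace ℝ (Fin d), ℝ) where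
  toFun z := Real.exp (-b * ‖z‖ ^ 2)
  smooth' := (contDiff_const.mul (contDiff_id.norm_sq ℝ)).exp
  decay' k n := gaussian_decay b hb k n

/-- The heat kernel `(4πt)^{-d/2} exp(-|z|²/(4t))` on `ℝ^d`. -/
noncomputable def heatKernel {d : ℕ} (t : ℝ) (z : EuclideanSpace ℝ (Fin d)) : ℝ :=
  (4 * Real.pi * t) ^ (-((d : ℝ) / 2)) * Real.exp (-‖z‖ ^ 2 / (4 * t))

/-- The function `y ↦ heatKernel t (x - y)`, `t > 0`, as a Schwartz function of `y`
(by convention `0` when `t ≤ 0`). -/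
noncomputable def schwartzHeatKernel {d : ℕ} (t : ℝ) (x : EuclideanSpace ℝ (Fin d)) :
    𝓢(EuclideanSpace ℝ (Fin d), ℝ) :=
  if ht : 0 < t then
    (4 * Real.pi * t) ^ (-((d : ℝ) / 2)) •
      SchwartzMap.compSubConstCLM ℝ x (schwartzGaussian d (1 / (4 * t)) (by positivity))
  else 0

theorem schwartzHeatKernel_apply {d : ℕ} (t : ℝ) (ht : 0 < t) (x y : EuclideanSpace ℝ (Fin d)) :
    schwartzHeatKernel t x y = heatKernel t (x - y) := by
  have h : schwartzGaussian d (1 / (4 * t)) (by positivity) (y - x)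
      = Real.exp (-(1 / (4 * t)) * ‖y - x‖ ^ 2) := rfl
  rw [schwartzHeatKernel, dif_pos ht, heatKernel, smul_apply,
    SchwartzMap.compSubConstCLM_apply, h, smul_eq_mul, norm_sub_rev]
  congr 2
  ring

/-- Real-valued tempered distributions on `ℝ^d`, i.e. the topological dual of the real Schwartz
space. Its topology is the strong dual topology (uniform convergence on bounded subsets of the
Schwartz space). -/
abbrev RealTemperedDistribution (d : ℕ) : Type :=
  𝓢(EuclideanSpace ℝ (Fin d), ℝ) →L[ℝ] ℝ

namespace RealTemperedDistribution

/-- The Dirac mass at `a`. -/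
noncomputable def dirac {d : ℕ} (a : EuclideanSpace ℝ (Fin d)) : RealTemperedDistribution d :=
  (BoundedContinuousFunction.evalCLM ℝ a).comp
    (SchwartzMap.toBoundedContinuousFunctionCLM ℝ (EuclideanSpace ℝ (Fin d)) ℝ)

/-- A non-negative distribution, i.e. a measure. -/
def IsNonneg {d : ℕ} (T : RealTemperedDistribution d) : Prop :=
  ∀ φ : 𝓢(EuclideanSpace ℝ (Fin d), ℝ), (∀ x, 0 ≤ φ x) → 0 ≤ T φ

/-- The translate of `T` by the vector `a`: `⟨translate a T, φ⟩ = ⟨T, φ(· + a)⟩`. -/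
noncomputable def translate {d : ℕ} (a : EuclideanSpace ℝ (Fin d))
    (T : RealTemperedDistribution d) : RealTemperedDistribution d :=
  T.comp (SchwartzMap.compSubConstCLM ℝ (-a))

/-- The dilate of `T` with factor `r ≠ 0`: `⟨dilate r T, φ⟩ = ⟨T, φ(r ·)⟩`. On measures this is
the push-forward under `x ↦ r x`; on functions it is `f ↦ |r|^{-d} f(r⁻¹ ·)`. -/
noncomputable def dilate {d : ℕ} (r : ℝ) (hr : r ≠ 0)
    (T : RealTemperedDistribution d) : RealTemperedDistribution d :=
  T.comp (SchwartzMap.compCLMOfContinuousLinearEquiv ℝ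
    (ContinuousLinearEquiv.smulLeft (R₁ := ℝ) (M₁ := EuclideanSpace ℝ (Fin d)) (Units.mk0 r hr)))

/-- The heat extension `H[T](x,t) = ⟨T, heatKernel t (x - ·)⟩` of a tempered distribution,
for `t > 0`. -/
noncomputable def heat {d : ℕ} (T : RealTemperedDistribution d)
    (x : EuclideanSpace ℝ (Fin d)) (t : ℝ) : ℝ :=
  T (schwartzHeatKernel t x)

end RealTemperedDistribution

/-- The heat extension of a function,
`H[f](x,t) = (4πt)^{-d/2} ∫ f(y) exp(-|x-y|²/(4t)) dy` for `t > 0`, with initial value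
`H[f](x,0) = f(x)`. -/
noncomputable def heatExtension {d : ℕ} (f : EuclideanSpace ℝ (Fin d) → ℝ)
    (x : EuclideanSpace ℝ (Fin d)) (t : ℝ) : ℝ :=
  if t = 0 then f x else ∫ y, f y * heatKernel t (x - y)

/-- The weighted norm `(∫ |f|^p w dx)^{1/p}`, with values in `[0,∞]`. -/
noncomputable def weightedLpNorm {d : ℕ} (p : ℝ) (w f : EuclideanSpace ℝ (Fin d) → ℝ) : ℝ≥0∞ :=
  (∫⁻ x, ENNReal.ofReal (|f x| ^ p * w x)) ^ (1 / p)

/-- The smoothness function `s[w](ζ) = sup {w(x)/w(y) : |x-y| ≤ ζ}` of a positive weight `w`,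
with values in `[0,∞]`. -/
noncomputable def smoothnessFunction {d : ℕ} (w : EuclideanSpace ℝ (Fin d) → ℝ) (ζ : ℝ) : ℝ≥0∞ :=
  ⨆ (x : EuclideanSpace ℝ (Fin d)) (y : EuclideanSpace ℝ (Fin d)) (_ : ‖x - y‖ ≤ ζ),
    ENNReal.ofReal (w x / w y)

/-- An invariant cone of measures: a closed, dilation and translation invariant set of
non-negative tempered distributions that is stable under multiplication by scalars `c ≥ 0`. -/
structure IsInvariantConeOfMeasures {d : ℕ} (M : Set (RealTemperedDistribution d)) : Prop where
  nonneg : ∀ T ∈ M, T.IsNonneg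
  isClosed : IsClosed M
  dilate_mem : ∀ T ∈ M, ∀ (r : ℝ) (hr : 0 < r), T.dilate r hr.ne' ∈ M
  translate_mem : ∀ T ∈ M, ∀ a : EuclideanSpace ℝ (Fin d), T.translate a ∈ M
  smul_mem : ∀ T ∈ M, ∀ c : ℝ, 0 ≤ c → c • T ∈ M

/-!
The argument is a stability version of Minkowski's inequality. Write `kₜ` for the heat kernel,
`u = H[μ](·, 1)`, and represent `μ` by a measure. Moving the heat extension from the weight `G` to the
function turns the left-hand side, raised to the power `p`, into the integral against `G` of
`V(x) = ∫ H[μ](z, t) ^ p k_{(1 - t)/p}(x - z) dz`. Multiplying Gaussians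
(`heatKernel_rpow_mul_heatKernel`) shows that
`V(x) = t ^ (-(d / 2) (p - 1)) ∫ (∫ ρ_y(z) ^ (1/p) k₁(x - y) dμ(y)) ^ p dz`, where `ρ_y` is a Gaussian
probability density centred at `(1 - t) y + t x`. By Minkowski's inequality
`V ≤ t ^ (-(d / 2) (p - 1)) u ^ p`, which is the claim with `δ = 0`, with equality for Dirac measures.

The gain comes from the fact that different `ρ_y` are different functions. Hölder's inequality bounds
the gap below by the defect of the Hellinger affinities `∫ (ρ_y ρ_{y'}) ^ (1/2)`, which are explicit
Gaussians in `y - y'`. This gives `lintegral_measureHeat_rpow_add_le`: the gap is at least a constant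
times `1 - t` times `u ^ p` times the normalized `spread` of `k₁(x - y) dμ(y)`, a bounded substitute for
its variance. The factor `1 - t` makes it possible to keep the constant `1` in front of the right-hand
side.

It remains to bound the average of the spread below (`exists_mul_lintegral_le_lintegral_spread`). If
this average is small, then an averaging argument produces a point `x` at which the spread is small
and around which `μ` grows at most polynomially, relative to `u(x)` and with constants depending only
on the data. A translate and multiple of `μ` is then close to `δ₀`, uniformly on a bounded set of
Schwartz functions (`exists_dirac_close`), which is excluded because the cone is closed in the strong
dual topology and omits `δ₀`. The inequality for `t ∈ [1/2, 1)` follows, and dilation invariance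
together with the semigroup law extends it to all `t`.
-/

/-! ### Representing a non-negative tempered distribution by a measure -/

/-- Cutting off at radius about `n + 1` approximates a Schwartz function, pointwise and in the
Schwartz topology, by compactly supported Schwartz functions that it dominates. -/
theorem exists_cutoff_schwartz_tendsto {d : ℕ} (φ : 𝓢(EuclideanSpace ℝ (Fin d), ℝ)) :
    ∃ ψ : ℕ → 𝓢(EuclideanSpace ℝ (Fin d), ℝ),
      (∀ n, HasCompactSupport (ψ n)) ∧ (∀ n x, |ψ n x| ≤ |φ x|) ∧
      (∀ n x, 0 ≤ φ x → 0 ≤ ψ n x) ∧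
      (∀ x, Filter.Tendsto (fun n => ψ n x) Filter.atTop (nhds (φ x))) ∧
      Filter.Tendsto ψ Filter.atTop (nhds φ) := by
  let b : ContDiffBump (0 : EuclideanSpace ℝ (Fin d)) := ⟨1, 2, one_pos, one_lt_two⟩
  let a : ℕ → ℝ := fun n => ((n : ℝ) + 1)⁻¹
  have ha0 : ∀ n, 0 < a n := fun n => by positivity
  have ha1 : ∀ n, a n ≤ 1 := fun n => inv_le_one_of_one_le₀ (by simp)
  have hsm : ∀ n, ContDiff ℝ (⊤ : ℕ∞) (fun x => b (a n • x) * φ x) := fun n =>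
    (b.contDiff.comp (contDiff_const_smul _)).mul (φ.smooth ⊤)
  have hcs : ∀ n, HasCompactSupport (fun x => b (a n • x) * φ x) := fun n =>
    (b.hasCompactSupport.comp_smul (ha0 n).ne').mul_right
  let ψ : ℕ → 𝓢(EuclideanSpace ℝ (Fin d), ℝ) := fun n => (hcs n).toSchwartzMap (hsm n)
  have hψ : ∀ n x, ψ n x = b (a n • x) * φ x := fun n x => rfl
  have hone : ∀ (n : ℕ) x, ‖x‖ ≤ (n : ℝ) + 1 → b (a n • x) = 1 := by
    intro n x hx
    apply b.one_of_mem_closedBall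
    rw [mem_closedBall_zero_iff, norm_smul, Real.norm_of_nonneg (ha0 n).le]
    change ((n : ℝ) + 1)⁻¹ * ‖x‖ ≤ 1
    rw [inv_mul_le_iff₀ (by positivity)]; linarith
  refine ⟨ψ, hcs, fun n x => ?_, fun n x hx => ?_, fun x => ?_, ?_⟩
  · rw [hψ, abs_mul, abs_of_nonneg b.nonneg]
    exact mul_le_of_le_one_left (abs_nonneg _) b.le_one
  · rw [hψ]; exact mul_nonneg b.nonneg hx
  · apply tendsto_const_nhds.congr'
    filter_upwards [Filter.eventually_ge_atTop ⌈‖x‖⌉₊] with n hn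
    rw [hψ, hone, one_mul]
    have := Nat.ceil_le.1 hn
    linarith
  · rw [(schwartz_withSeminorms ℝ (EuclideanSpace ℝ (Fin d)) ℝ).tendsto_nhds_atTop]
    rintro ⟨k, m⟩ ε hε
    -- derivatives of `1 - b` are bounded, and `ψ n - φ` vanishes on the ball of radius `n + 1`,
    -- so one extra power of `‖x‖` gains the factor `a n`
    have hB : ∀ i : ℕ, ∃ B : ℝ, ∀ x, ‖iteratedFDeriv ℝ i (fun x => 1 - b x) x‖ ≤ B := by
      intro i
      obtain ⟨B, hB⟩ := ((b.contDiff (n := (⊤ : ℕ∞))).continuous_iteratedFDeriv (m := i)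
        (by exact_mod_cast le_top)).bounded_above_of_compact_support
          (b.hasCompactSupport.iteratedFDeriv i)
      refine ⟨1 + B, fun x => ?_⟩
      have h := iteratedFDeriv_sub_apply (𝕜 := ℝ) (i := i) (x := x)
        (contDiff_const (c := (1 : ℝ))).contDiffAt (b.contDiff (n := i)).contDiffAt
      change ‖iteratedFDeriv ℝ i ((fun _ : EuclideanSpace ℝ (Fin d) => (1 : ℝ)) - ⇑b) x‖ ≤ 1 + B
      rw [h]
      refine (norm_sub_le _ _).trans (add_le_add ?_ (hB x))
      rcases i.eq_zero_or_pos with rfl | hi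
      · simp
      · rw [iteratedFDeriv_const_of_ne hi.ne']; simp
    choose B hB using hB
    have hB0 : ∀ i, 0 ≤ B i := fun i => (norm_nonneg _).trans (hB i 0)
    set S : ℝ := ∑ i ∈ Finset.range (m + 1),
      (m.choose i : ℝ) * B i * SchwartzMap.seminorm ℝ (k + 1) (m - i) φ with hS
    have hS0 : 0 ≤ S := Finset.sum_nonneg fun i _ =>
      mul_nonneg (mul_nonneg (by positivity) (hB0 i)) (apply_nonneg _ _)
    have key : ∀ n, SchwartzMap.seminorm ℝ k m (ψ n - φ) ≤ a n * S := by
      intro n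
      refine SchwartzMap.seminorm_le_bound ℝ k m _ (mul_nonneg (ha0 n).le hS0) fun x => ?_
      have hfun : ⇑(ψ n - φ) = fun x => -((1 - b (a n • x)) * φ x) := by
        ext x
        change b (a n • x) * φ x - φ x = _
        ring
      rw [hfun]
      rcases lt_or_ge ‖x‖ ((n : ℝ) + 1) with hx | hx
      · have h0 : (fun x => -((1 - b (a n • x)) * φ x)) =ᶠ[nhds x] fun _ => (0 : ℝ) := by
          filter_upwards [(isOpen_lt continuous_norm continuous_const).mem_nhds hx] with y hy
          rw [hone n y (le_of_lt hy)]; simp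
        rw [(h0.iteratedFDeriv (𝕜 := ℝ) m).eq_of_nhds, iteratedFDeriv_fun_zero]
        simpa using mul_nonneg (ha0 n).le hS0
      · have hneg : (fun x => -((1 - b (a n • x)) * φ x)) =
            -(fun x => (1 - b (a n • x)) * φ x) := rfl
        rw [hneg, iteratedFDeriv_neg_apply, norm_neg]
        have hax : 1 ≤ a n * ‖x‖ := by
          change 1 ≤ ((n : ℝ) + 1)⁻¹ * ‖x‖
          rw [le_inv_mul_iff₀ (by positivity)]; linarith
        have hb1 : ContDiff ℝ (⊤ : ℕ∞) (fun x => 1 - b x) := contDiff_const.sub b.contDiff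
        have hmul := norm_iteratedFDeriv_mul_le (𝕜 := ℝ) (n := m) (N := (⊤ : ℕ∞))
          (hb1.comp (contDiff_const_smul (a n))) (φ.smooth ⊤) x (by exact_mod_cast le_top)
        have hterm : ∀ i ∈ Finset.range (m + 1),
            ‖x‖ ^ k * ((m.choose i : ℝ) * ‖iteratedFDeriv ℝ i (fun x => 1 - b (a n • x)) x‖ *
              ‖iteratedFDeriv ℝ (m - i) φ x‖) ≤
            a n * ((m.choose i : ℝ) * B i * SchwartzMap.seminorm ℝ (k + 1) (m - i) φ) := by
          intro i _
          have h1 : ‖iteratedFDeriv ℝ i (fun x => 1 - b (a n • x)) x‖ ≤ B i := by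
            have := congrFun (iteratedFDeriv_comp_const_smul (𝕜 := ℝ) (a n)
              (hb1.of_le (m := i) (by exact_mod_cast le_top))) x
            rw [this, norm_smul, norm_pow, Real.norm_of_nonneg (ha0 n).le]
            exact (mul_le_of_le_one_left (norm_nonneg _) (pow_le_one₀ (ha0 n).le (ha1 n))).trans
              (hB i _)
          have h2 := φ.le_seminorm ℝ (k + 1) (m - i) x
          calc _ ≤ (a n * ‖x‖) * (‖x‖ ^ k * ((m.choose i : ℝ) * B i *
                ‖iteratedFDeriv ℝ (m - i) φ x‖)) := by
                refine le_trans ?_ (le_mul_of_one_le_left ?_ hax)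
                · gcongr
                · have := hB0 i
                  positivity
            _ = a n * ((m.choose i : ℝ) * B i *
                (‖x‖ ^ (k + 1) * ‖iteratedFDeriv ℝ (m - i) φ x‖)) := by ring
            _ ≤ _ := by
                have := hB0 i
                have := (ha0 n).le
                gcongr
        calc _ ≤ ‖x‖ ^ k * _ := mul_le_mul_of_nonneg_left hmul (by positivity)
          _ ≤ a n * S := by
            rw [Finset.mul_sum, hS, Finset.mul_sum]
            exact Finset.sum_le_sum hterm
    have hlim : Filter.Tendsto (fun n => a n * S) Filter.atTop (nhds 0) := by
      have := (tendsto_one_div_add_atTop_nhds_zero_nat (𝕜 := ℝ)).mul_const S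
      simpa [a] using this
    obtain ⟨N, hN⟩ := Filter.eventually_atTop.1 (hlim.eventually_lt_const hε)
    exact ⟨N, fun n hn => (key n).trans_lt (hN n hn)⟩

/-- The restriction of `T` to smooth compactly supported functions extends to a positive functional
on `C_c` by the M. Riesz extension theorem, and is then an integral by Riesz–Markov–Kakutani. -/
theorem exists_measure_integral_eq_of_hasCompactSupport {d : ℕ} (T : RealTemperedDistribution d)
    (hT : T.IsNonneg) :
    ∃ μ : Measure (EuclideanSpace ℝ (Fin d)), IsFiniteMeasureOnCompacts μ ∧
      ∀ φ : 𝓢(EuclideanSpace ℝ (Fin d), ℝ), HasCompactSupport φ → T φ = ∫ x, φ x ∂μ := by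
  let f : CompactlySupportedContinuousMap (EuclideanSpace ℝ (Fin d)) ℝ →ₗ.[ℝ] ℝ :=
    { domain :=
        { carrier := {g | ContDiff ℝ (⊤ : ℕ∞) g}
          add_mem' := fun {a b} (hf : ContDiff ℝ (⊤ : ℕ∞) a) (hg : ContDiff ℝ (⊤ : ℕ∞) b) => hf.add hg
          zero_mem' := (contDiff_const :
            ContDiff ℝ (⊤ : ℕ∞) fun _ : EuclideanSpace ℝ (Fin d) => (0 : ℝ))
          smul_mem' := fun c g (hg : ContDiff ℝ (⊤ : ℕ∞) g) =>
            (contDiff_const (c := c)).smul hg }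
      toFun :=
        { toFun := fun g => T (g.1.hasCompactSupport.toSchwartzMap g.2)
          map_add' := fun g h => by rw [← map_add]; rfl
          map_smul' := fun c g => by rw [← map_smul]; rfl } }
  let s : PointedCone ℝ (CompactlySupportedContinuousMap (EuclideanSpace ℝ (Fin d)) ℝ) :=
    { carrier := {g | 0 ≤ g}
      add_mem' := fun {a b} ha hb x => add_nonneg (ha x) (hb x)
      zero_mem' := le_refl (0 : CompactlySupportedContinuousMap (EuclideanSpace ℝ (Fin d)) ℝ)
      smul_mem' := fun c a ha x => mul_nonneg c.2 (ha x) }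
  obtain ⟨g, hg, hpos⟩ := riesz_extension s f
    (fun x hx => hT _ fun y => hx y) (fun y => by
      obtain ⟨R, hR⟩ := y.hasCompactSupport.isCompact.isBounded.subset_closedBall 0
      obtain ⟨C, hC⟩ := y.hasCompactSupport.exists_bound_of_continuous y.continuous
      let b : ContDiffBump (0 : EuclideanSpace ℝ (Fin d)) :=
        ⟨max R 1, max R 1 + 1, by positivity, by linarith⟩
      refine ⟨⟨|C| • ⟨⟨b, b.continuous⟩, b.hasCompactSupport⟩, contDiff_const.smul b.contDiff⟩, ?_⟩
      intro x
      change 0 ≤ |C| * b x + y x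
      by_cases hx : x ∈ tsupport y
      · rw [b.one_of_mem_closedBall]
        · have := neg_abs_le (y x)
          have := hC x
          rw [Real.norm_eq_abs] at this
          linarith [le_abs_self C]
        · exact Metric.closedBall_subset_closedBall (le_max_left _ _) (hR hx)
      · rw [image_eq_zero_of_notMem_tsupport hx, add_zero]
        exact mul_nonneg (abs_nonneg _) b.nonneg)
  let Λ := PositiveLinearMap.mk₀ g hpos
  refine ⟨RealRMK.rieszMeasure Λ, inferInstance, fun φ hφ => ?_⟩
  have := RealRMK.integral_rieszMeasure Λ ⟨⟨φ, φ.continuous⟩, hφ⟩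
  refine Eq.trans ?_ this.symm
  exact (hg ⟨⟨⟨φ, φ.continuous⟩, hφ⟩, φ.smooth ⊤⟩).symm

/-- The measure `μ` represents the non-negative tempered distribution `T`. Non-negative Schwartz
functions are then `μ`-integrable; for signed ones integrability is a hypothesis, since temperate
growth of `μ` is not part of the definition. -/
structure RealTemperedDistribution.IsRepresentedBy {d : ℕ} (T : RealTemperedDistribution d)
    (μ : Measure (EuclideanSpace ℝ (Fin d))) : Prop where
  isFiniteMeasureOnCompacts : IsFiniteMeasureOnCompacts μ
  apply_eq_integral : ∀ φ : 𝓢(EuclideanSpace ℝ (Fin d), ℝ), Integrable φ μ → T φ = ∫ x, φ x ∂μ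
  integrable_of_nonneg : ∀ φ : 𝓢(EuclideanSpace ℝ (Fin d), ℝ), (∀ x, 0 ≤ φ x) → Integrable φ μ

theorem RealTemperedDistribution.IsNonneg.exists_isRepresentedBy {d : ℕ}
    {T : RealTemperedDistribution d} (hT : T.IsNonneg) : ∃ μ, T.IsRepresentedBy μ := by
  obtain ⟨μ, hμ, hμT⟩ := exists_measure_integral_eq_of_hasCompactSupport T hT
  refine ⟨μ, hμ, fun φ hφ => ?_, fun φ hφ => ?_⟩
  · obtain ⟨ψ, hcs, hle, -, hlim, hψ⟩ := exists_cutoff_schwartz_tendsto φ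
    have h1 := (T.continuous.tendsto φ).comp hψ
    have h2 : Filter.Tendsto (fun n => ∫ x, ψ n x ∂μ) Filter.atTop (nhds (∫ x, φ x ∂μ)) :=
      tendsto_integral_of_dominated_convergence (fun x => |φ x|)
        (fun n => (ψ n).continuous.aestronglyMeasurable) hφ.abs
        (fun n => .of_forall fun x => by simpa using hle n x) (.of_forall hlim)
    refine tendsto_nhds_unique h1 (h2.congr fun n => (hμT _ (hcs n)).symm)
  · obtain ⟨ψ, hcs, hle, hnn, hlim, hψ⟩ := exists_cutoff_schwartz_tendsto φ
    have h1 := (T.continuous.tendsto φ).comp hψ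
    refine ⟨φ.continuous.aestronglyMeasurable, ?_⟩
    rw [hasFiniteIntegral_iff_ofReal (.of_forall hφ)]
    have h2 : ∀ n, ∫⁻ x, ENNReal.ofReal (ψ n x) ∂μ = ENNReal.ofReal (T (ψ n)) := fun n => by
      rw [hμT _ (hcs n), ofReal_integral_eq_lintegral_ofReal
        ((ψ n).continuous.integrable_of_hasCompactSupport (hcs n))
        (.of_forall fun x => hnn n x (hφ x))]
    -- Fatou
    have h3 := lintegral_liminf_le (u := Filter.atTop) (μ := μ) (f := fun n x => ENNReal.ofReal (ψ n x))
      (fun n => (ψ n).continuous.measurable.ennreal_ofReal)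
    have h4 : Filter.liminf (fun n => ENNReal.ofReal (T (ψ n))) Filter.atTop =
        ENNReal.ofReal (T φ) :=
      ((ENNReal.continuous_ofReal.tendsto _).comp h1).liminf_eq
    have h5 : ∀ x, Filter.liminf (fun n => ENNReal.ofReal (ψ n x)) Filter.atTop =
        ENNReal.ofReal (φ x) :=
      fun x => ((ENNReal.continuous_ofReal.tendsto _).comp (hlim x)).liminf_eq
    simp_rw [h2, h4, h5] at h3
    exact h3.trans_lt ENNReal.ofReal_lt_top

/-! ### Products, powers and affinities of heat kernels -/

theorem heatKernel_pos {d : ℕ} {t : ℝ} (ht : 0 < t) (z : EuclideanSpace ℝ (Fin d)) :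
    0 < heatKernel t z := by
  unfold heatKernel; positivity

theorem continuous_heatKernel {d : ℕ} (t : ℝ) :
    Continuous (heatKernel t : EuclideanSpace ℝ (Fin d) → ℝ) := by
  unfold heatKernel; fun_prop

theorem heatKernel_neg {d : ℕ} (t : ℝ) (z : EuclideanSpace ℝ (Fin d)) :
    heatKernel t (-z) = heatKernel t z := by
  simp [heatKernel]

theorem heatKernel_sub_comm {d : ℕ} (t : ℝ) (x y : EuclideanSpace ℝ (Fin d)) :
    heatKernel t (x - y) = heatKernel t (y - x) := by
  rw [← heatKernel_neg, neg_sub]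

theorem lintegral_heatKernel {d : ℕ} {t : ℝ} (ht : 0 < t) :
    ∫⁻ z : EuclideanSpace ℝ (Fin d), ENNReal.ofReal (heatKernel t z) = 1 := by
  have hb : 0 < 1 / (4 * t) := by positivity
  have hint : Integrable (heatKernel t : EuclideanSpace ℝ (Fin d) → ℝ) := by
    have h := (schwartzGaussian d (1 / (4 * t)) hb).integrable (μ := volume)
    refine (h.const_mul ((4 * Real.pi * t) ^ (-((d : ℝ) / 2)))).congr (.of_forall fun z => ?_)
    change _ * Real.exp (-(1 / (4 * t)) * ‖z‖ ^ 2) = _ * _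
    congr 2; ring
  rw [← ofReal_integral_eq_lintegral_ofReal hint (.of_forall fun z => (heatKernel_pos ht z).le),
    ← ENNReal.ofReal_one]
  congr 1
  have h := GaussianFourier.integral_rexp_neg_mul_sq_norm (V := EuclideanSpace ℝ (Fin d)) hb
  have h2 : ∀ z : EuclideanSpace ℝ (Fin d), heatKernel t z
      = (4 * Real.pi * t) ^ (-((d : ℝ) / 2)) * Real.exp (-(1 / (4 * t)) * ‖z‖ ^ 2) := by
    intro z; unfold heatKernel; congr 2; ring
  simp_rw [h2]
  rw [integral_const_mul, h, finrank_euclideanSpace, Fintype.card_fin,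
    show Real.pi / (1 / (4 * t)) = 4 * Real.pi * t by field_simp,
    ← Real.rpow_add (by positivity)]
  simp

theorem lintegral_heatKernel_sub {d : ℕ} {t : ℝ} (ht : 0 < t) (a : EuclideanSpace ℝ (Fin d)) :
    ∫⁻ z, ENNReal.ofReal (heatKernel t (z - a)) = 1 := by
  rw [lintegral_sub_right_eq_self (fun z => ENNReal.ofReal (heatKernel t z)) a,
    lintegral_heatKernel ht]

/-- Completing the square for a sum of two weighted squared distances. -/
theorem norm_sq_div_add_norm_sq_div {V : Type*} [NormedAddCommGroup V] [InnerProductSpace ℝ V]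
    {s t : ℝ} (hs : 0 < s) (ht : 0 < t) (x y z : V) :
    ‖z - y‖ ^ 2 / s + ‖x - z‖ ^ 2 / t =
      ‖x - y‖ ^ 2 / (s + t) + ‖z - (s + t)⁻¹ • (t • y + s • x)‖ ^ 2 / (s * t / (s + t)) := by
  have hst : (s + t) ≠ 0 := by positivity
  have h1 : x - y = (z - y) + (x - z) := by abel
  have h2 : z - (s + t)⁻¹ • (t • y + s • x) = (s + t)⁻¹ • (t • (z - y) - s • (x - z)) := by
    have : z = (s + t)⁻¹ • ((s + t) • z) := by rw [smul_smul, inv_mul_cancel₀ hst, one_smul]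
    conv_lhs => rw [this]
    rw [← smul_sub]
    congr 1
    module
  rw [h2, h1, norm_smul, mul_pow, Real.norm_of_nonneg (by positivity)]
  generalize z - y = a
  generalize x - z = b
  rw [norm_add_sq_real, norm_sub_sq_real, inner_smul_left, inner_smul_right, norm_smul, norm_smul,
    Real.norm_of_nonneg hs.le, Real.norm_of_nonneg ht.le]
  simp only [conj_trivial]
  field_simp
  ring

/-- The product of two heat kernels in the same variable is again a heat kernel in that variable,
centred at a weighted mean; integrating it gives the semigroup law. -/
theorem heatKernel_mul_heatKernel {d : ℕ} {s t : ℝ} (hs : 0 < s) (ht : 0 < t)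
    (x y z : EuclideanSpace ℝ (Fin d)) :
    heatKernel s (z - y) * heatKernel t (x - z) =
      heatKernel (s + t) (x - y) *
        heatKernel (s * t / (s + t)) (z - (s + t)⁻¹ • (t • y + s • x)) := by
  unfold heatKernel
  rw [mul_mul_mul_comm ((4 * Real.pi * s) ^ _),
    mul_mul_mul_comm ((4 * Real.pi * (s + t)) ^ _), ← Real.exp_add, ← Real.exp_add,
    ← Real.mul_rpow (by positivity) (by positivity),
    ← Real.mul_rpow (by positivity) (by positivity)]
  have h := norm_sq_div_add_norm_sq_div hs ht x y z
  congr 2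
  · field_simp
  · have e : ∀ a r : ℝ, -a / (4 * r) = -(1 / 4) * (a / r) := fun a r => by
      rw [neg_div, mul_comm 4 r, ← div_div]; ring
    rw [e, e, e, e, ← mul_add, h, mul_add]

/-- A power of a Gaussian is, up to a constant, a Gaussian at the time `t / q`. -/
theorem heatKernel_rpow {d : ℕ} {t q : ℝ} (ht : 0 < t) (hq : 0 < q)
    (z : EuclideanSpace ℝ (Fin d)) :
    heatKernel t z ^ q =
      (4 * Real.pi * t) ^ (-((d : ℝ) / 2) * (q - 1)) * q ^ (-((d : ℝ) / 2)) *
        heatKernel (t / q) z := by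
  unfold heatKernel
  rw [Real.mul_rpow (by positivity) (by positivity), ← Real.exp_mul,
    ← Real.rpow_mul (by positivity), ← mul_assoc]
  congr 1
  · rw [mul_assoc (_ ^ _), ← Real.mul_rpow (by positivity) (by positivity),
      show q * (4 * Real.pi * (t / q)) = 4 * Real.pi * t by field_simp,
      ← Real.rpow_add (by positivity)]
    congr 1; ring
  · congr 1; field_simp

/-- The Hellinger affinity of two Gaussian densities. -/
theorem lintegral_sqrt_heatKernel_mul {d : ℕ} {s : ℝ} (hs : 0 < s)
    (a b : EuclideanSpace ℝ (Fin d)) :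
    ∫⁻ z, ENNReal.ofReal (heatKernel s (z - a)) ^ (1 / 2 : ℝ) *
        ENNReal.ofReal (heatKernel s (z - b)) ^ (1 / 2 : ℝ) =
      ENNReal.ofReal (Real.exp (-‖a - b‖ ^ 2 / (16 * s))) := by
  have key : ∀ z, ENNReal.ofReal (heatKernel s (z - a)) ^ (1 / 2 : ℝ) *
        ENNReal.ofReal (heatKernel s (z - b)) ^ (1 / 2 : ℝ) =
      ENNReal.ofReal (Real.exp (-‖a - b‖ ^ 2 / (16 * s))) *
        ENNReal.ofReal (heatKernel s (z - (s + s)⁻¹ • (s • a + s • b))) := by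
    intro z
    have p1 := heatKernel_pos hs (z - a)
    have p2 := heatKernel_pos hs (z - b)
    have p3 := heatKernel_pos (t := s + s) (by positivity) (b - a)
    rw [ENNReal.ofReal_rpow_of_pos p1, ENNReal.ofReal_rpow_of_pos p2,
      ← ENNReal.ofReal_mul (by positivity), ← ENNReal.ofReal_mul (by positivity),
      ← Real.mul_rpow p1.le p2.le, heatKernel_sub_comm s z b, heatKernel_mul_heatKernel hs hs,
      Real.mul_rpow p3.le (heatKernel_pos (by positivity) _).le,
      heatKernel_rpow (t := s * s / (s + s)) (by positivity) (by norm_num),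
      show s * s / (s + s) / (1 / 2) = s by field_simp; ring, ← mul_assoc]
    congr 2
    unfold heatKernel
    rw [Real.mul_rpow (by positivity) (by positivity), ← Real.exp_mul,
      ← Real.rpow_mul (by positivity), norm_sub_rev b a]
    have e1 : -‖a - b‖ ^ 2 / (4 * (s + s)) * (1 / 2) = -‖a - b‖ ^ 2 / (16 * s) := by
      field_simp; ring
    rw [e1, mul_right_comm]
    have e2 : (4 * Real.pi * (s + s)) ^ (-((d : ℝ) / 2) * (1 / 2)) *
        ((4 * Real.pi * (s * s / (s + s))) ^ (-((d : ℝ) / 2) * (1 / 2 - 1)) *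
          (1 / 2) ^ (-((d : ℝ) / 2))) = 1 := by
      have h1 : 4 * Real.pi * (s + s) = (4 * Real.pi * (s * s / (s + s))) * (1 / 2) ^ (-2 : ℝ) := by
        rw [Real.rpow_neg (by norm_num)]
        norm_num
        field_simp
        ring
      have h3 : (4 * Real.pi * (s * s / (s + s))) ^ (-((d : ℝ) / 2) * (1 / 2)) *
          (4 * Real.pi * (s * s / (s + s))) ^ (-((d : ℝ) / 2) * (1 / 2 - 1)) = 1 := by
        rw [← Real.rpow_add (by positivity)]
        ring_nf
        simp
      have h4 : ((1 / 2 : ℝ) ^ (-2 : ℝ)) ^ (-((d : ℝ) / 2) * (1 / 2)) *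
          (1 / 2) ^ (-((d : ℝ) / 2)) = 1 := by
        rw [← Real.rpow_mul (by norm_num), ← Real.rpow_add (by norm_num)]
        ring_nf
        simp
      rw [h1, Real.mul_rpow (by positivity) (by positivity), mul_mul_mul_comm, h3, h4, one_mul]
    rw [e2, one_mul]
  simp_rw [key]
  rw [lintegral_const_mul' _ _ ENNReal.ofReal_ne_top, lintegral_heatKernel_sub hs, mul_one]

/-- For fixed `x` and `y`, the left-hand side is a Gaussian in `z` of total mass
`t ^ (-(d / 2) (p - 1)) k₁(x - y) ^ p`. Thus, integrated in `z`, the norm inequality with `δ = 0` is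
an equality for the Dirac mass at `y`. -/
theorem heatKernel_rpow_mul_heatKernel {d : ℕ} {t p : ℝ} (hp : 0 < p) (ht : 0 < t) (ht1 : t < 1)
    (x y z : EuclideanSpace ℝ (Fin d)) :
    heatKernel t (z - y) ^ p * heatKernel ((1 - t) / p) (x - z) =
      t ^ (-((d : ℝ) / 2) * (p - 1)) * heatKernel 1 (x - y) ^ p *
        heatKernel (t * (1 - t) / p) (z - ((1 - t) • y + t • x)) := by
  have ht' : 0 < 1 - t := by linarith
  rw [heatKernel_rpow ht hp, heatKernel_rpow one_pos hp, mul_assoc,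
    heatKernel_mul_heatKernel (div_pos ht hp) (div_pos ht' hp),
    show t / p + (1 - t) / p = 1 / p by ring,
    show t / p * ((1 - t) / p) / (1 / p) = t * (1 - t) / p by field_simp,
    show 4 * Real.pi * t = t * (4 * Real.pi * 1) by ring, Real.mul_rpow ht.le (by positivity)]
  have : (1 / p)⁻¹ • (((1 - t) / p) • y + (t / p) • x) = (1 - t) • y + t • x := by
    rw [smul_add, smul_smul, smul_smul]
    congr 2 <;> field_simp
  rw [this]
  ring

/-! ### Stability in Minkowski's inequality and the pointwise deficit -/

/-- The heat kernel with values in `[0,∞]`. -/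
noncomputable def ennHeatKernel {d : ℕ} (t : ℝ) (z : EuclideanSpace ℝ (Fin d)) : ℝ≥0∞ :=
  ENNReal.ofReal (heatKernel t z)

/-- The heat extension of a measure, with values in `[0,∞]`. -/
noncomputable def measureHeat {d : ℕ} (μ : Measure (EuclideanSpace ℝ (Fin d))) (t : ℝ)
    (x : EuclideanSpace ℝ (Fin d)) : ℝ≥0∞ :=
  ∫⁻ y, ennHeatKernel t (x - y) ∂μ

/-- The double integral of `1 - exp(-c|y - y'|²)` against two copies of the measure
`k₁(x - y) dμ(y)`: a bounded substitute for its variance, not normalized by the square of its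
total mass `H[μ](x, 1)`. -/
noncomputable def spread {d : ℕ} (c : ℝ) (μ : Measure (EuclideanSpace ℝ (Fin d)))
    (x : EuclideanSpace ℝ (Fin d)) : ℝ≥0∞ :=
  ∫⁻ y, ∫⁻ y', ENNReal.ofReal (1 - Real.exp (-(c * ‖y - y'‖ ^ 2))) *
    (ennHeatKernel 1 (x - y) * ennHeatKernel 1 (x - y')) ∂μ ∂μ

theorem measurable_ennHeatKernel {d : ℕ} (t : ℝ) :
    Measurable (ennHeatKernel t : EuclideanSpace ℝ (Fin d) → ℝ≥0∞) :=
  (continuous_heatKernel t).measurable.ennreal_ofReal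

theorem measurable_measureHeat {d : ℕ} (μ : Measure (EuclideanSpace ℝ (Fin d))) [SFinite μ]
    (t : ℝ) : Measurable (measureHeat μ t) :=
  Measurable.lintegral_prod_right' (f := fun q : EuclideanSpace ℝ (Fin d) ×
    EuclideanSpace ℝ (Fin d) => ennHeatKernel t (q.1 - q.2))
    ((measurable_ennHeatKernel t).comp (measurable_fst.sub measurable_snd))

theorem measurable_spread {d : ℕ} (c : ℝ) (μ : Measure (EuclideanSpace ℝ (Fin d))) [SFinite μ] :
    Measurable (spread c μ) := by
  have h := measurable_ennHeatKernel (d := d) 1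
  refine Measurable.lintegral_prod_right' (f := fun q : EuclideanSpace ℝ (Fin d) ×
    EuclideanSpace ℝ (Fin d) => ∫⁻ y', ENNReal.ofReal (1 - Real.exp (-(c * ‖q.2 - y'‖ ^ 2))) *
    (ennHeatKernel 1 (q.1 - q.2) * ennHeatKernel 1 (q.1 - y')) ∂μ) ?_
  refine Measurable.lintegral_prod_right' (f := fun q : (EuclideanSpace ℝ (Fin d) ×
    EuclideanSpace ℝ (Fin d)) × EuclideanSpace ℝ (Fin d) =>
    ENNReal.ofReal (1 - Real.exp (-(c * ‖q.1.2 - q.2‖ ^ 2))) *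
    (ennHeatKernel 1 (q.1.1 - q.1.2) * ennHeatKernel 1 (q.1.1 - q.2))) ?_
  have h1 : Measurable fun q : (EuclideanSpace ℝ (Fin d) × EuclideanSpace ℝ (Fin d)) ×
      EuclideanSpace ℝ (Fin d) => ENNReal.ofReal (1 - Real.exp (-(c * ‖q.1.2 - q.2‖ ^ 2))) := by
    fun_prop
  exact h1.mul ((h.comp (measurable_fst.fst.sub measurable_fst.snd)).mul
    (h.comp (measurable_fst.fst.sub measurable_snd)))

section Affinity

variable {α β : Type*} [MeasurableSpace α] [MeasurableSpace β]

/-- Jensen's inequality, comparing the exponents `1 / p ≤ 1 / 2`. -/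
theorem lintegral_lintegral_rpow_le_of_two_le (ν : Measure α) [SFinite ν] (m : Measure β)
    {ρ : α → β → ℝ≥0∞} (hρ : Measurable (Function.uncurry ρ)) {p : ℝ} (hp : 2 ≤ p) :
    ∫⁻ z, (∫⁻ y, ρ y z ^ (1 / p) ∂ν) ^ p ∂m ≤
      (∫⁻ z, (∫⁻ y, ρ y z ^ (1 / 2 : ℝ) ∂ν) ^ (2 : ℝ) ∂m) * ν Set.univ ^ (p - 2) := by
  have hmeas : ∀ z, Measurable fun y => ρ y z := fun z => hρ.comp measurable_prodMk_right
  rw [← lintegral_mul_const]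
  · refine lintegral_mono fun z => ?_
    have h := ENNReal.lintegral_mul_norm_pow_le (μ := ν) (f := fun y => ρ y z ^ (1 / 2 : ℝ))
      (g := fun _ => 1) ((hmeas z).pow_const _).aemeasurable aemeasurable_const
      (p := 2 / p) (q := 1 - 2 / p) (by positivity)
      (by rw [sub_nonneg, div_le_one (by linarith)]; exact hp) (by ring)
    simp only [← ENNReal.rpow_mul, ENNReal.one_rpow, mul_one, lintegral_const, one_mul] at h
    rw [show (1 / 2 : ℝ) * (2 / p) = 1 / p by ring] at h
    refine (ENNReal.rpow_le_rpow h (by linarith)).trans ?_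
    rw [ENNReal.mul_rpow_of_nonneg _ _ (by linarith), ← ENNReal.rpow_mul, ← ENNReal.rpow_mul,
      show 2 / p * p = 2 by field_simp, show (1 - 2 / p) * p = p - 2 by field_simp]
  · refine Measurable.pow_const ?_ _
    exact Measurable.lintegral_prod_right' (f := fun q : β × α => ρ q.2 q.1 ^ (1 / 2 : ℝ))
      ((hρ.comp measurable_swap).pow_const _)

/-- Hölder's inequality, interpolating the exponent `1 / p` between `1 / 2` and `1`. -/
theorem lintegral_lintegral_rpow_le_of_le_two (ν : Measure α) [SFinite ν] (m : Measure β)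
    [SFinite m] {ρ : α → β → ℝ≥0∞} (hρ : Measurable (Function.uncurry ρ))
    (h1 : ∀ y, ∫⁻ z, ρ y z ∂m = 1) {p : ℝ} (hp1 : 1 ≤ p) (hp : p ≤ 2) :
    ∫⁻ z, (∫⁻ y, ρ y z ^ (1 / p) ∂ν) ^ p ∂m ≤
      (∫⁻ z, (∫⁻ y, ρ y z ^ (1 / 2 : ℝ) ∂ν) ^ (2 : ℝ) ∂m) ^ (p - 1) * ν Set.univ ^ (2 - p) := by
  have hp0 : 0 < p := by linarith
  have hmeas : ∀ z, Measurable fun y => ρ y z := fun z => hρ.comp measurable_prodMk_right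
  have hswap : Measurable fun q : β × α => ρ q.2 q.1 := hρ.comp measurable_swap
  have hA : Measurable fun z => ∫⁻ y, ρ y z ^ (1 / 2 : ℝ) ∂ν :=
    Measurable.lintegral_prod_right' (f := fun q : β × α => ρ q.2 q.1 ^ (1 / 2 : ℝ))
      (hswap.pow_const _)
  have hB : Measurable fun z => ∫⁻ y, ρ y z ∂ν :=
    Measurable.lintegral_prod_right' (f := fun q : β × α => ρ q.2 q.1) hswap
  have hmass : ∫⁻ z, ∫⁻ y, ρ y z ∂ν ∂m = ν Set.univ := by
    rw [lintegral_lintegral_swap hswap.aemeasurable]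
    simp [h1]
  rw [← hmass]
  refine le_trans (lintegral_mono fun z => ?_) (ENNReal.lintegral_mul_norm_pow_le
    (hA.pow_const 2).aemeasurable hB.aemeasurable (by linarith) (by linarith) (by ring))
  have h := ENNReal.lintegral_mul_norm_pow_le (μ := ν) (f := fun y => ρ y z ^ (1 / 2 : ℝ))
    (g := fun y => ρ y z) ((hmeas z).pow_const _).aemeasurable (hmeas z).aemeasurable
    (p := 2 * (p - 1) / p) (q := (2 - p) / p) (div_nonneg (by linarith) hp0.le)
    (div_nonneg (by linarith) hp0.le) (by field_simp; ring)
  have he : ∀ y, (ρ y z ^ (1 / 2 : ℝ)) ^ (2 * (p - 1) / p) * ρ y z ^ ((2 - p) / p)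
      = ρ y z ^ (1 / p) := fun y => by
    rw [← ENNReal.rpow_mul, ← ENNReal.rpow_add_of_nonneg _ _ _ (div_nonneg (by linarith) hp0.le)]
    · congr 1; field_simp; ring
    · exact mul_nonneg (by norm_num) (div_nonneg (by linarith) hp0.le)
  simp_rw [he] at h
  refine (ENNReal.rpow_le_rpow h hp0.le).trans_eq ?_
  rw [ENNReal.mul_rpow_of_nonneg _ _ hp0.le, ← ENNReal.rpow_mul, ← ENNReal.rpow_mul,
    ← ENNReal.rpow_mul]
  congr 2 <;> field_simp

/-- Stability in Minkowski's inequality for a family of probability densities `ρ y`: if the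
integrated Hellinger affinity falls short of its maximal value by `D`, then the inequality
`‖∫ ρ y ^ (1/p) dν(y)‖_p ≤ ν(univ)`, raised to the power `p`, has a gap proportional to `D`. -/
theorem lintegral_lintegral_rpow_add_le (ν : Measure α) [IsFiniteMeasure ν] (m : Measure β)
    [SFinite m] {ρ : α → β → ℝ≥0∞} (hρ : Measurable (Function.uncurry ρ))
    (h1 : ∀ y, ∫⁻ z, ρ y z ∂m = 1) {p : ℝ} (hp1 : 1 < p) {D : ℝ≥0∞}
    (hD : ∫⁻ z, (∫⁻ y, ρ y z ^ (1 / 2 : ℝ) ∂ν) ^ (2 : ℝ) ∂m + D ≤ ν Set.univ ^ (2 : ℝ)) :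
    ∫⁻ z, (∫⁻ y, ρ y z ^ (1 / p) ∂ν) ^ p ∂m +
      ENNReal.ofReal (min 1 (p - 1)) * (D * ν Set.univ ^ (p - 2)) ≤ ν Set.univ ^ p := by
  have hp0 : 0 < p := by linarith
  rcases eq_or_ne (ν Set.univ) 0 with h0 | h0
  · have hν : ν = 0 := Measure.measure_univ_eq_zero.1 h0
    have hD0 : D = 0 := by
      have := (le_add_self).trans hD
      rw [h0, ENNReal.zero_rpow_of_pos two_pos] at this
      exact le_antisymm this zero_le
    subst hν
    simp [hD0, hp0]
  have htop : ν Set.univ ≠ ∞ := measure_ne_top _ _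
  set u := ν Set.univ with hu
  set Q := ∫⁻ z, (∫⁻ y, ρ y z ^ (1 / 2 : ℝ) ∂ν) ^ (2 : ℝ) ∂m with hQ
  have hu2 : u ^ (2 : ℝ) * u ^ (p - 2) = u ^ p := by
    rw [← ENNReal.rpow_add _ _ h0 htop]; congr 1; ring
  have hmain : (Q + D) * u ^ (p - 2) ≤ u ^ p := hu2 ▸ mul_le_mul_left hD _
  rcases le_total 2 p with hp | hp
  · rw [min_eq_left (by linarith), ENNReal.ofReal_one, one_mul]
    refine (add_le_add_left (lintegral_lintegral_rpow_le_of_two_le ν m hρ hp) _).trans ?_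
    rwa [← add_mul]
  · rw [min_eq_right (by linarith)]
    refine (add_le_add_left (lintegral_lintegral_rpow_le_of_le_two ν m hρ h1 hp1.le hp) _).trans ?_
    have hQtop : Q ≠ ∞ := ne_top_of_le_ne_top (ENNReal.rpow_ne_top_of_nonneg two_pos.le htop)
      (le_self_add.trans hD)
    -- weighted arithmetic-geometric mean inequality between `Q u ^ (p - 2)` and `u ^ p`
    have hyoung : Q ^ (p - 1) * u ^ (2 - p) ≤
        ENNReal.ofReal (p - 1) * (Q * u ^ (p - 2)) + ENNReal.ofReal (2 - p) * u ^ p := by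
      have hu' : 0 < u.toReal := ENNReal.toReal_pos h0 htop
      have h := Real.geom_mean_le_arith_mean2_weighted (w₁ := p - 1) (w₂ := 2 - p)
        (p₁ := Q.toReal * u.toReal ^ (p - 2)) (p₂ := u.toReal ^ p) (by linarith) (by linarith)
        (by positivity) (by positivity) (by ring)
      rw [Real.mul_rpow (by positivity) (by positivity), mul_assoc, ← Real.rpow_mul hu'.le,
        ← Real.rpow_mul hu'.le, ← Real.rpow_add hu',
        show (p - 2) * (p - 1) + p * (2 - p) = 2 - p by ring] at h
      have h' := ENNReal.ofReal_le_ofReal h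
      rw [ENNReal.ofReal_add (mul_nonneg (by linarith) (by positivity))
        (mul_nonneg (by linarith) (by positivity)), ENNReal.ofReal_mul (by positivity),
        ENNReal.ofReal_mul (by linarith), ENNReal.ofReal_mul (by positivity),
        ENNReal.ofReal_mul (by linarith), ← ENNReal.ofReal_rpow_of_nonneg (by positivity) (by linarith),
        ← ENNReal.ofReal_rpow_of_pos hu', ← ENNReal.ofReal_rpow_of_pos hu',
        ← ENNReal.ofReal_rpow_of_pos hu', ENNReal.ofReal_toReal hQtop,
        ENNReal.ofReal_toReal htop] at h'
      exact h'
    calc _ ≤ ENNReal.ofReal (p - 1) * (Q * u ^ (p - 2)) + ENNReal.ofReal (2 - p) * u ^ p +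
          ENNReal.ofReal (p - 1) * (D * u ^ (p - 2)) := add_le_add_left hyoung _
      _ = ENNReal.ofReal (p - 1) * ((Q + D) * u ^ (p - 2)) + ENNReal.ofReal (2 - p) * u ^ p := by
          ring
      _ ≤ ENNReal.ofReal (p - 1) * u ^ p + ENNReal.ofReal (2 - p) * u ^ p := by gcongr
      _ = u ^ p := by
          rw [← add_mul, ← ENNReal.ofReal_add (by linarith) (by linarith)]
          simp [show p - 1 + (2 - p) = 1 by ring]

end Affinity

/-- Convexity of `s ↦ exp(-s r)` on `[0, 1]`. -/
theorem exp_neg_mul_add_le_one {s r : ℝ} (hs0 : 0 ≤ s) (hs1 : s ≤ 1) :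
    Real.exp (-(s * r)) + s * (1 - Real.exp (-r)) ≤ 1 := by
  have h := Real.geom_mean_le_arith_mean2_weighted (w₁ := s) (w₂ := 1 - s)
    (p₁ := Real.exp (-r)) (p₂ := 1) hs0 (by linarith) (Real.exp_pos _).le zero_le_one (by ring)
  rw [← Real.exp_mul, Real.one_rpow, show -r * s = -(s * r) by ring] at h
  linarith

/-- The measure `k₁(x - y) dμ(y)` for the heat kernel `k₁` at time `1`, whose total mass is the heat
extension of `μ` at `(x, 1)`. -/
noncomputable def gaussianTilt {d : ℕ} (μ : Measure (EuclideanSpace ℝ (Fin d)))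
    (x : EuclideanSpace ℝ (Fin d)) : Measure (EuclideanSpace ℝ (Fin d)) :=
  μ.withDensity fun y => ennHeatKernel 1 (x - y)

theorem measurable_ennHeatKernel_sub {d : ℕ} (t : ℝ) (x : EuclideanSpace ℝ (Fin d)) :
    Measurable fun y => ennHeatKernel t (x - y) :=
  (measurable_ennHeatKernel t).comp (measurable_const.sub measurable_id)

theorem gaussianTilt_univ {d : ℕ} (μ : Measure (EuclideanSpace ℝ (Fin d)))
    (x : EuclideanSpace ℝ (Fin d)) : gaussianTilt μ x Set.univ = measureHeat μ 1 x := by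
  rw [gaussianTilt, withDensity_apply _ MeasurableSet.univ, Measure.restrict_univ]; rfl

theorem lintegral_gaussianTilt {d : ℕ} (μ : Measure (EuclideanSpace ℝ (Fin d)))
    (x : EuclideanSpace ℝ (Fin d)) {f : EuclideanSpace ℝ (Fin d) → ℝ≥0∞} (hf : Measurable f) :
    ∫⁻ y, f y ∂gaussianTilt μ x = ∫⁻ y, f y * ennHeatKernel 1 (x - y) ∂μ := by
  rw [gaussianTilt, lintegral_withDensity_eq_lintegral_mul _ (measurable_ennHeatKernel_sub 1 x) hf]
  exact lintegral_congr fun y => mul_comm _ _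

theorem measurable_lintegral_one_sub_exp {d : ℕ} (c : ℝ)
    (ν : Measure (EuclideanSpace ℝ (Fin d))) [SFinite ν] :
    Measurable fun y => ∫⁻ y', ENNReal.ofReal (1 - Real.exp (-(c * ‖y - y'‖ ^ 2))) ∂ν :=
  Measurable.lintegral_prod_right' (f := fun q : EuclideanSpace ℝ (Fin d) ×
    EuclideanSpace ℝ (Fin d) => ENNReal.ofReal (1 - Real.exp (-(c * ‖q.1 - q.2‖ ^ 2))))
    (by fun_prop)

theorem spread_eq_lintegral_gaussianTilt {d : ℕ} (c : ℝ)
    (μ : Measure (EuclideanSpace ℝ (Fin d))) [SFinite μ] (x : EuclideanSpace ℝ (Fin d)) :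
    spread c μ x = ∫⁻ y, ∫⁻ y', ENNReal.ofReal (1 - Real.exp (-(c * ‖y - y'‖ ^ 2)))
      ∂gaussianTilt μ x ∂gaussianTilt μ x := by
  have : SFinite (gaussianTilt μ x) := by unfold gaussianTilt; infer_instance
  rw [lintegral_gaussianTilt _ _ (measurable_lintegral_one_sub_exp c _)]
  refine lintegral_congr fun y => ?_
  have hm : Measurable fun y' => ENNReal.ofReal (1 - Real.exp (-(c * ‖y - y'‖ ^ 2))) := by fun_prop
  have hm2 : Measurable fun y' => ENNReal.ofReal (1 - Real.exp (-(c * ‖y - y'‖ ^ 2))) *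
      ennHeatKernel 1 (x - y') := hm.mul (measurable_ennHeatKernel_sub 1 x)
  rw [lintegral_gaussianTilt _ _ hm, ← lintegral_mul_const _ hm2]
  exact lintegral_congr fun y' => by ring

/-- The integrated Hellinger affinity of a family of translates of one Gaussian density. -/
theorem lintegral_lintegral_sqrt_ennHeatKernel_sq {d : ℕ}
    (ν : Measure (EuclideanSpace ℝ (Fin d))) [SFinite ν] {s : ℝ} (hs : 0 < s)
    {c : EuclideanSpace ℝ (Fin d) → EuclideanSpace ℝ (Fin d)} (hc : Measurable c) :
    ∫⁻ z, (∫⁻ y, ennHeatKernel s (z - c y) ^ (1 / 2 : ℝ) ∂ν) ^ (2 : ℝ) =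
      ∫⁻ y, ∫⁻ y', ENNReal.ofReal (Real.exp (-‖c y - c y'‖ ^ 2 / (16 * s))) ∂ν ∂ν := by
  have hk := measurable_ennHeatKernel (d := d) s
  have e1 : ∀ z, (∫⁻ y, ennHeatKernel s (z - c y) ^ (1 / 2 : ℝ) ∂ν) ^ (2 : ℝ) =
      ∫⁻ y, ∫⁻ y', ennHeatKernel s (z - c y) ^ (1 / 2 : ℝ) *
        ennHeatKernel s (z - c y') ^ (1 / 2 : ℝ) ∂ν ∂ν := fun z => by
    have hm : Measurable fun y => ennHeatKernel s (z - c y) ^ (1 / 2 : ℝ) :=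
      (hk.comp (measurable_const.sub hc)).pow_const _
    simp_rw [lintegral_const_mul _ hm]
    rw [lintegral_mul_const _ hm, ENNReal.rpow_two, sq]
  simp_rw [e1]
  rw [lintegral_lintegral_swap]
  · refine lintegral_congr fun y => ?_
    rw [lintegral_lintegral_swap]
    · exact lintegral_congr fun y' => lintegral_sqrt_heatKernel_mul hs _ _
    · refine Measurable.aemeasurable (Measurable.mul ?_ ?_)
      · exact (hk.comp (measurable_fst.sub measurable_const)).pow_const _
      · exact (hk.comp (measurable_fst.sub (hc.comp measurable_snd))).pow_const _
  · refine Measurable.aemeasurable ?_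
    refine Measurable.lintegral_prod_right' (f := fun q : (EuclideanSpace ℝ (Fin d) ×
      EuclideanSpace ℝ (Fin d)) × EuclideanSpace ℝ (Fin d) =>
      ennHeatKernel s (q.1.1 - c q.1.2) ^ (1 / 2 : ℝ) *
        ennHeatKernel s (q.1.1 - c q.2) ^ (1 / 2 : ℝ)) (Measurable.mul ?_ ?_)
    · exact (hk.comp (measurable_fst.fst.sub (hc.comp measurable_fst.snd))).pow_const _
    · exact (hk.comp (measurable_fst.fst.sub (hc.comp measurable_snd))).pow_const _

/-- The affinity of the Gaussians centred at `(1 - t) y + t x` falls short of `ν(univ)²` by at least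
`1 - t` times a quantity that does not depend on `t`. -/
theorem lintegral_exp_neg_add_le {d : ℕ} (ν : Measure (EuclideanSpace ℝ (Fin d))) [SFinite ν]
    {p t : ℝ} (hp : 0 < p) (ht : 0 < t) (ht1 : t < 1) (x : EuclideanSpace ℝ (Fin d)) :
    ∫⁻ y, ∫⁻ y', ENNReal.ofReal (Real.exp (-‖((1 - t) • y + t • x) -
        ((1 - t) • y' + t • x)‖ ^ 2 / (16 * (t * (1 - t) / p)))) ∂ν ∂ν +
      ENNReal.ofReal (1 - t) * ∫⁻ y, ∫⁻ y',
        ENNReal.ofReal (1 - Real.exp (-(p / 16 * ‖y - y'‖ ^ 2))) ∂ν ∂ν ≤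
      ν Set.univ ^ (2 : ℝ) := by
  have ht' : 0 < 1 - t := by linarith
  have hin2 : ∀ y : EuclideanSpace ℝ (Fin d), Measurable fun y' => ENNReal.ofReal
      (1 - Real.exp (-(p / 16 * ‖y - y'‖ ^ 2))) := fun y => by fun_prop
  have hin3 := measurable_lintegral_one_sub_exp (p / 16) ν
  rw [← lintegral_const_mul _ hin3, ← lintegral_add_right _ (hin3.const_mul _)]
  refine (lintegral_mono (g := fun _ => ν Set.univ) fun y => ?_).trans_eq
    (by rw [lintegral_const, ENNReal.rpow_two, sq])
  rw [← lintegral_const_mul _ (hin2 y), ← lintegral_add_right _ ((hin2 y).const_mul _)]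
  refine (lintegral_mono (g := fun _ => 1) fun y' => ?_).trans_eq (by simp)
  have hr : (0 : ℝ) ≤ 1 - Real.exp (-(p / 16 * ‖y - y'‖ ^ 2)) := by
    rw [sub_nonneg, Real.exp_le_one_iff, neg_nonpos]; positivity
  rw [← ENNReal.ofReal_mul ht'.le, ← ENNReal.ofReal_add (Real.exp_pos _).le (by positivity),
    ← ENNReal.ofReal_one]
  refine ENNReal.ofReal_le_ofReal (le_trans ?_ (exp_neg_mul_add_le_one
    (r := p / 16 * ‖y - y'‖ ^ 2) ht'.le (by linarith)))
  gcongr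
  rw [add_sub_add_right_eq_sub, ← smul_sub, norm_smul, Real.norm_of_nonneg ht'.le, mul_pow,
    neg_div, neg_le_neg_iff]
  rw [show (1 - t) ^ 2 * ‖y - y'‖ ^ 2 / (16 * (t * (1 - t) / p)) =
    (1 - t) * (p / 16 * ‖y - y'‖ ^ 2) / t by field_simp]
  exact le_div_self (by positivity) ht ht1.le

/-- `heatKernel_rpow_mul_heatKernel` integrated against `μ`: the integrand of `H[H[μ](·, t) ^ p]` at
`x` is the `p`-th power of an average of `p`-th roots of Gaussian densities. -/
theorem measureHeat_rpow_mul_ennHeatKernel {d : ℕ} (μ : Measure (EuclideanSpace ℝ (Fin d)))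
    {p t : ℝ} (hp0 : 0 < p) (ht : 0 < t) (ht1 : t < 1) (x z : EuclideanSpace ℝ (Fin d)) :
    measureHeat μ t z ^ p * ennHeatKernel ((1 - t) / p) (x - z) =
      ENNReal.ofReal (t ^ (-((d : ℝ) / 2) * (p - 1))) *
        (∫⁻ y, ennHeatKernel (t * (1 - t) / p) (z - ((1 - t) • y + t • x)) ^ (1 / p)
          ∂gaussianTilt μ x) ^ p := by
  have hρ : Measurable fun y =>
      ennHeatKernel (t * (1 - t) / p) (z - ((1 - t) • y + t • x)) ^ (1 / p) :=
    ((measurable_ennHeatKernel _).comp (by fun_prop)).pow_const _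
  rw [lintegral_gaussianTilt _ _ hρ]
  set A := ENNReal.ofReal (t ^ (-((d : ℝ) / 2) * (p - 1))) with hA
  set K := ennHeatKernel ((1 - t) / p) (x - z) with hK
  have hcancel : ∀ a : ℝ≥0∞, (a ^ (1 / p)) ^ p = a := fun a => by
    rw [← ENNReal.rpow_mul, one_div_mul_cancel hp0.ne', ENNReal.rpow_one]
  have hcancel2 : ∀ a : ℝ≥0∞, (a ^ p) ^ (1 / p) = a := fun a => by
    rw [← ENNReal.rpow_mul, mul_one_div_cancel hp0.ne', ENNReal.rpow_one]
  have hmain : ∀ y, ennHeatKernel t (z - y) * K ^ (1 / p) = A ^ (1 / p) *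
      (ennHeatKernel (t * (1 - t) / p) (z - ((1 - t) • y + t • x)) ^ (1 / p) *
        ennHeatKernel 1 (x - y)) := fun y => by
    have h := heatKernel_rpow_mul_heatKernel hp0 ht ht1 x y z
    have h2 : ennHeatKernel t (z - y) ^ p * K = A * (ennHeatKernel (t * (1 - t) / p)
        (z - ((1 - t) • y + t • x)) * ennHeatKernel 1 (x - y) ^ p) := by
      rw [hK, hA, mul_comm (ennHeatKernel (t * (1 - t) / p) _)]
      unfold ennHeatKernel
      rw [ENNReal.ofReal_rpow_of_pos (heatKernel_pos ht _),
        ENNReal.ofReal_rpow_of_pos (heatKernel_pos one_pos _),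
        ← ENNReal.ofReal_mul (Real.rpow_nonneg (heatKernel_pos ht _).le _), h,
        ← ENNReal.ofReal_mul (Real.rpow_nonneg (heatKernel_pos one_pos _).le _),
        ← ENNReal.ofReal_mul (Real.rpow_nonneg ht.le _), mul_assoc]
    have h3 := congrArg (fun a => a ^ (1 / p)) h2
    simpa only [ENNReal.mul_rpow_of_nonneg _ _ (one_div_nonneg.2 hp0.le), hcancel2] using h3
  calc measureHeat μ t z ^ p * K = (measureHeat μ t z * K ^ (1 / p)) ^ p := by
        rw [ENNReal.mul_rpow_of_nonneg _ _ hp0.le, hcancel]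
    _ = (A ^ (1 / p) * ∫⁻ y, ennHeatKernel (t * (1 - t) / p)
        (z - ((1 - t) • y + t • x)) ^ (1 / p) * ennHeatKernel 1 (x - y) ∂μ) ^ p := by
        have hm : Measurable fun y => ennHeatKernel (t * (1 - t) / p)
            (z - ((1 - t) • y + t • x)) ^ (1 / p) * ennHeatKernel 1 (x - y) :=
          hρ.mul (measurable_ennHeatKernel_sub 1 x)
        rw [measureHeat, ← lintegral_mul_const _ (measurable_ennHeatKernel_sub t z),
          ← lintegral_const_mul _ hm]
        simp_rw [hmain]
    _ = _ := by rw [ENNReal.mul_rpow_of_nonneg _ _ hp0.le, hcancel]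

/-- The pointwise form of the improved inequality: evolving `H[μ](·, t) ^ p` for the remaining time
`(1 - t) / p` gives at most `t ^ (-(d / 2) (p - 1)) H[μ](x, 1) ^ p`, with a gap of order `1 - t` times
the spread of `μ` seen from `x`. -/
theorem lintegral_measureHeat_rpow_add_le {d : ℕ} (μ : Measure (EuclideanSpace ℝ (Fin d)))
    [SFinite μ] {p t : ℝ} (hp : 1 < p) (ht : 0 < t) (ht1 : t < 1) (x : EuclideanSpace ℝ (Fin d))
    (hx : measureHeat μ 1 x ≠ ∞) :
    (∫⁻ z, measureHeat μ t z ^ p * ennHeatKernel ((1 - t) / p) (x - z)) +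
      ENNReal.ofReal (t ^ (-((d : ℝ) / 2) * (p - 1))) *
        (ENNReal.ofReal (min 1 (p - 1) * (1 - t)) *
          (spread (p / 16) μ x * measureHeat μ 1 x ^ (p - 2))) ≤
      ENNReal.ofReal (t ^ (-((d : ℝ) / 2) * (p - 1))) * measureHeat μ 1 x ^ p := by
  have hp0 : 0 < p := by linarith
  have ht' : 0 < 1 - t := by linarith
  have hσ : 0 < t * (1 - t) / p := by positivity
  have : IsFiniteMeasure (gaussianTilt μ x) := ⟨by rw [gaussianTilt_univ]; exact hx.lt_top⟩
  have haff := lintegral_exp_neg_add_le (gaussianTilt μ x) hp0 ht ht1 x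
  rw [← spread_eq_lintegral_gaussianTilt, ← lintegral_lintegral_sqrt_ennHeatKernel_sq _ hσ
    (c := fun y => (1 - t) • y + t • x) (by fun_prop)] at haff
  have hmink := lintegral_lintegral_rpow_add_le (gaussianTilt μ x) volume
    (ρ := fun y z => ennHeatKernel (t * (1 - t) / p) (z - ((1 - t) • y + t • x)))
    ((measurable_ennHeatKernel _).comp (by fun_prop))
    (fun y => lintegral_heatKernel_sub hσ _) hp haff
  simp_rw [measureHeat_rpow_mul_ennHeatKernel μ hp0 ht ht1 x]
  rw [lintegral_const_mul' _ _ ENNReal.ofReal_ne_top, ← mul_add,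
    ENNReal.ofReal_mul (le_min zero_le_one (by linarith))]
  rw [gaussianTilt_univ] at hmink
  refine mul_le_mul_right (le_trans (le_of_eq ?_) hmink) _
  ring

/-! ### Separation from the Dirac measure -/

/-- Closedness in the strong dual topology, made quantitative: the elements of `M` stay away from
`δ₀`, uniformly, on one bounded set of Schwartz functions. -/
theorem exists_bounded_separating_dirac {d : ℕ} {M : Set (RealTemperedDistribution d)}
    (hM : IsClosed M) (hδ : RealTemperedDistribution.dirac 0 ∉ M) :
    ∃ (P : ℕ → ℕ → ℝ) (ε : ℝ), 0 < ε ∧ ∀ T ∈ M, ∃ φ : 𝓢(EuclideanSpace ℝ (Fin d), ℝ),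
      (∀ k n, SchwartzMap.seminorm ℝ k n φ ≤ P k n) ∧ ε ≤ |T φ - φ 0| := by
  have h1 : (fun S => RealTemperedDistribution.dirac 0 + S) ⁻¹' Mᶜ ∈
      nhds (0 : RealTemperedDistribution d) := by
    refine (hM.isOpen_compl.preimage (continuous_const.add continuous_id)).mem_nhds ?_
    simpa using hδ
  obtain ⟨⟨B, V⟩, ⟨hB, hV⟩, hBV⟩ := ContinuousLinearMap.hasBasis_nhds_zero.mem_iff.1 h1
  obtain ⟨ε, hε, hεV⟩ := Metric.mem_nhds_iff.1 hV
  rw [(schwartz_withSeminorms ℝ _ ℝ).isVonNBounded_iff_seminorm_bounded] at hB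
  choose r hr hrB using hB
  refine ⟨fun k n => r (k, n), ε, hε, fun T hT => ?_⟩
  by_contra! hcon
  have hmem : T - RealTemperedDistribution.dirac 0 ∈
      {f : RealTemperedDistribution d | ∀ x ∈ B, f x ∈ V} := fun φ hφ => by
    refine hεV ?_
    have := hcon φ fun k n => (hrB (k, n) φ hφ).le
    rw [mem_ball_zero_iff]
    exact this
  exact hBV hmem (by simpa using hT)

theorem SchwartzMap.abs_sub_le_seminorm {d : ℕ} (φ : 𝓢(EuclideanSpace ℝ (Fin d), ℝ))
    (a b : EuclideanSpace ℝ (Fin d)) :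
    |φ a - φ b| ≤ SchwartzMap.seminorm ℝ 0 1 φ * ‖a - b‖ := by
  have h := Convex.norm_image_sub_le_of_norm_fderiv_le (𝕜 := ℝ) (f := φ)
    (C := SchwartzMap.seminorm ℝ 0 1 φ) (s := Set.univ) (x := b) (y := a)
    (fun x _ => φ.differentiableAt) (fun x _ => by
      have := φ.norm_iteratedFDeriv_le_seminorm ℝ 1 x
      rwa [norm_iteratedFDeriv_one] at this) convex_univ trivial trivial
  exact h

theorem SchwartzMap.one_add_norm_pow_mul_abs_le {d : ℕ} (φ : 𝓢(EuclideanSpace ℝ (Fin d), ℝ))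
    {P : ℕ → ℕ → ℝ} (hP : ∀ k n, SchwartzMap.seminorm ℝ k n φ ≤ P k n) (L : ℕ)
    (x : EuclideanSpace ℝ (Fin d)) :
    (1 + ‖x‖) ^ L * |φ x| ≤ 2 ^ L * (P 0 0 + P L 0) := by
  have h1 := φ.norm_pow_mul_le_seminorm ℝ L x
  have h0 := φ.norm_le_seminorm ℝ x
  rw [Real.norm_eq_abs] at h0 h1
  have h2 : (1 + ‖x‖) ^ L ≤ 2 ^ L * (1 + ‖x‖ ^ L) := by
    have := add_pow_le (zero_le_one (α := ℝ)) (norm_nonneg x) L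
    rw [one_pow] at this
    refine this.trans ?_
    gcongr
    · norm_num
    · omega
  calc (1 + ‖x‖) ^ L * |φ x| ≤ 2 ^ L * (1 + ‖x‖ ^ L) * |φ x| := by gcongr
    _ = 2 ^ L * (|φ x| + ‖x‖ ^ L * |φ x|) := by ring
    _ ≤ _ := by
      gcongr
      · exact h0.trans (hP 0 0)
      · exact h1.trans (hP L 0)

theorem exists_one_add_norm_pow_mul_heatKernel_le {d : ℕ} (L : ℕ) :
    ∃ K : ℝ, 0 < K ∧ ∀ z : EuclideanSpace ℝ (Fin d), (1 + ‖z‖) ^ L * heatKernel 1 z ≤ K := by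
  obtain ⟨K, hK⟩ := one_add_pow_mul_exp_neg_sq_le (1 / 4) (by norm_num) L
  have hK0 : 0 < K := lt_of_lt_of_le (by positivity) (hK 0 le_rfl)
  refine ⟨(4 * Real.pi * 1) ^ (-((d : ℝ) / 2)) * K, by positivity, fun z => ?_⟩
  have := hK ‖z‖ (norm_nonneg z)
  unfold heatKernel
  calc _ = (4 * Real.pi * 1) ^ (-((d : ℝ) / 2)) *
        ((1 + ‖z‖) ^ L * Real.exp (-(1 / 4) * ‖z‖ ^ 2)) := by
        rw [show -‖z‖ ^ 2 / (4 * 1) = -(1 / 4) * ‖z‖ ^ 2 by ring]; ring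
    _ ≤ _ := by gcongr

theorem exists_heatKernel_lipschitz (d : ℕ) :
    ∃ K : ℝ, 0 ≤ K ∧ ∀ a b : EuclideanSpace ℝ (Fin d),
      |heatKernel 1 a - heatKernel 1 b| ≤ K * ‖a - b‖ := by
  refine ⟨SchwartzMap.seminorm ℝ 0 1 (schwartzHeatKernel 1 (0 : EuclideanSpace ℝ (Fin d))),
    apply_nonneg _ _, fun a b => ?_⟩
  have h := (schwartzHeatKernel 1 (0 : EuclideanSpace ℝ (Fin d))).abs_sub_le_seminorm a b
  simpa [schwartzHeatKernel_apply _ one_pos, heatKernel_neg] using h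

theorem le_heatKernel_one_of_norm_le {d : ℕ} {a : EuclideanSpace ℝ (Fin d)} {R : ℝ} (h : ‖a‖ ≤ R) :
    (4 * Real.pi * 1) ^ (-((d : ℝ) / 2)) * Real.exp (-R ^ 2 / (4 * 1)) ≤ heatKernel 1 a := by
  unfold heatKernel; gcongr

/-- A quantity `v` that is small near `y₀` and decays at infinity is bounded by a small multiple of a
decaying weight, plus a large multiple of a weight that vanishes only at `y₀`. The three cases of the
proof are `y` far from `x`, `y` close to `y₀`, and the remaining compact region. -/
theorem exists_abs_le_decay_add_spread (d : ℕ) (L : ℕ) {c η : ℝ} (hc : 0 < c) (hη : 0 < η)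
    (A₁ A₂ : ℝ) :
    ∃ B : ℝ, 0 ≤ B ∧ ∀ (x y₀ y : EuclideanSpace ℝ (Fin d)) (v : ℝ), |v| ≤ A₁ * ‖y - y₀‖ →
      (1 + ‖x - y‖) ^ (L + 1) * |v| ≤ A₂ →
      |v| ≤ η * ((1 + ‖x - y‖) ^ L)⁻¹ +
        B * ((1 - Real.exp (-(c * ‖y - y₀‖ ^ 2))) * heatKernel 1 (x - y)) := by
  set R : ℝ := 1 + |A₂| / η with hR
  have hR1 : 1 ≤ R := by rw [hR]; have : 0 ≤ |A₂| / η := by positivity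
                         linarith
  set r : ℝ := η * (R ^ L)⁻¹ / (1 + |A₁|) with hr
  have hr0 : 0 < r := by positivity
  set κ : ℝ := (4 * Real.pi * 1) ^ (-((d : ℝ) / 2)) * Real.exp (-R ^ 2 / (4 * 1)) with hκ
  have hκ0 : 0 < κ := by positivity
  have hm : 0 < 1 - Real.exp (-(c * r ^ 2)) := by
    rw [sub_pos, Real.exp_lt_one_iff, neg_lt_zero]; positivity
  refine ⟨|A₂| / ((1 - Real.exp (-(c * r ^ 2))) * κ), by positivity, fun x y₀ y v h1 h2 => ?_⟩
  set q := 1 + ‖x - y‖ with hq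
  have hq1 : 1 ≤ q := by rw [hq]; linarith [norm_nonneg (x - y)]
  have hq0 : 0 < q := by linarith
  have hk := heatKernel_pos one_pos (x - y)
  have he : 0 ≤ 1 - Real.exp (-(c * ‖y - y₀‖ ^ 2)) := by
    rw [sub_nonneg, Real.exp_le_one_iff, neg_nonpos]; positivity
  have h2' : q ^ (L + 1) * |v| ≤ |A₂| := h2.trans (le_abs_self _)
  have hsecond : 0 ≤ |A₂| / ((1 - Real.exp (-(c * r ^ 2))) * κ) *
      ((1 - Real.exp (-(c * ‖y - y₀‖ ^ 2))) * heatKernel 1 (x - y)) := by positivity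
  rcases le_total R q with hRq | hRq
  · have : |v| ≤ η * (q ^ L)⁻¹ := by
      rw [← div_eq_mul_inv, le_div_iff₀ (by positivity)]
      have h3 : |A₂| ≤ η * q := by
        have : |A₂| / η ≤ q := by linarith
        rwa [div_le_iff₀ hη, mul_comm] at this
      rw [pow_succ] at h2'
      have : q * (|v| * q ^ L) ≤ q * η := by nlinarith
      exact le_of_mul_le_mul_left this hq0
    linarith
  · rcases le_total ‖y - y₀‖ r with hyr | hyr
    · have : |v| ≤ η * (q ^ L)⁻¹ := by
        calc |v| ≤ A₁ * ‖y - y₀‖ := h1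
          _ ≤ (1 + |A₁|) * r := by
            have := le_abs_self A₁
            gcongr; linarith
          _ = η * (R ^ L)⁻¹ := by rw [hr]; field_simp
          _ ≤ η * (q ^ L)⁻¹ := by gcongr
      linarith
    · -- here both factors of the second weight are bounded below
      have hv : |v| ≤ |A₂| := by
        refine le_trans ?_ h2'
        exact le_mul_of_one_le_left (abs_nonneg _) (one_le_pow₀ hq1)
      have hkκ : κ ≤ heatKernel 1 (x - y) := le_heatKernel_one_of_norm_le (by linarith)
      have hexp : 1 - Real.exp (-(c * r ^ 2)) ≤ 1 - Real.exp (-(c * ‖y - y₀‖ ^ 2)) := by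
        gcongr
      have h3 : |A₂| ≤ |A₂| / ((1 - Real.exp (-(c * r ^ 2))) * κ) *
          ((1 - Real.exp (-(c * ‖y - y₀‖ ^ 2))) * heatKernel 1 (x - y)) := by
        rw [div_mul_eq_mul_div, le_div_iff₀ (by positivity)]
        gcongr
      have : 0 ≤ η * (q ^ L)⁻¹ := by positivity
      linarith

/-! ### Measures of small spread are close to Dirac measures -/

/-- If `μ` has small spread seen from `x` and controlled growth, then there is a point `y₀` around
which the measure `k₁(x - y) dμ(y)` concentrates and at which `k₁(x - ·)` is not too small. Both
properties are obtained at once, by averaging over `y₀`. -/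
theorem exists_center {d : ℕ} (L : ℕ) (c : ℝ) {Λ ε : ℝ} (hΛ : 0 ≤ Λ) (hε : 0 < ε)
    (μ : Measure (EuclideanSpace ℝ (Fin d))) [SFinite μ] (x : EuclideanSpace ℝ (Fin d))
    (hu0 : measureHeat μ 1 x ≠ 0) (hut : measureHeat μ 1 x ≠ ∞)
    (hdec : ∫⁻ y, ENNReal.ofReal (((1 + ‖x - y‖) ^ L)⁻¹) ∂μ ≤
      ENNReal.ofReal Λ * measureHeat μ 1 x)
    (hsp : spread c μ x ≤ ENNReal.ofReal ε * measureHeat μ 1 x ^ (2 : ℝ)) :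
    ∃ y₀, ∫⁻ y, ENNReal.ofReal (1 - Real.exp (-(c * ‖y - y₀‖ ^ 2))) * ennHeatKernel 1 (x - y) ∂μ ≤
        ENNReal.ofReal (ε * (1 + Λ)) * measureHeat μ 1 x ∧
      1 ≤ (1 + Λ) * ((1 + ‖x - y₀‖) ^ L * heatKernel 1 (x - y₀)) := by
  set u := measureHeat μ 1 x with hu
  set ν := gaussianTilt μ x with hν
  have hνu : ν Set.univ = u := gaussianTilt_univ μ x
  have hfin : IsFiniteMeasure ν := ⟨by rw [hνu]; exact hut.lt_top⟩
  have hν0 : ν ≠ 0 := fun h => hu0 (by rw [← hνu, h]; simp)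
  let F : EuclideanSpace ℝ (Fin d) → ℝ≥0∞ := fun y₀ =>
    ∫⁻ y, ENNReal.ofReal (1 - Real.exp (-(c * ‖y₀ - y‖ ^ 2))) ∂ν
  let J : EuclideanSpace ℝ (Fin d) → ℝ≥0∞ := fun y =>
    ENNReal.ofReal (((1 + ‖x - y‖) ^ L)⁻¹ / heatKernel 1 (x - y))
  have hF : Measurable F := measurable_lintegral_one_sub_exp c ν
  have hJ : Measurable J := by
    have := continuous_heatKernel (d := d) 1
    have h1 : Continuous fun y => ((1 + ‖x - y‖) ^ L)⁻¹ / heatKernel 1 (x - y) :=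
      Continuous.div (Continuous.inv₀ (by fun_prop) fun y => by positivity) (by fun_prop)
        fun y => (heatKernel_pos one_pos _).ne'
    exact h1.measurable.ennreal_ofReal
  have hFi : ∫⁻ y, F y ∂ν ≤ ENNReal.ofReal ε * u * u := by
    rw [mul_assoc, ← sq, ← ENNReal.rpow_two]
    exact (spread_eq_lintegral_gaussianTilt c μ x).symm.le.trans hsp
  have hJi : ∫⁻ y, J y ∂ν ≤ ENNReal.ofReal Λ * u := by
    rw [hν, lintegral_gaussianTilt _ _ hJ]
    refine le_trans (le_of_eq (lintegral_congr fun y => ?_)) hdec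
    have hk := heatKernel_pos one_pos (x - y)
    rw [ennHeatKernel, ← ENNReal.ofReal_mul (by positivity), div_mul_cancel₀ _ hk.ne']
  have htot : ∫⁻ y, (F y + ENNReal.ofReal ε * u * J y) ∂ν ≤
      ENNReal.ofReal (ε * (1 + Λ)) * u * u := by
    rw [lintegral_add_left hF, lintegral_const_mul _ hJ]
    calc _ ≤ ENNReal.ofReal ε * u * u + ENNReal.ofReal ε * u * (ENNReal.ofReal Λ * u) := by
          gcongr
      _ = _ := by
          rw [ENNReal.ofReal_mul hε.le, ENNReal.ofReal_add zero_le_one hΛ, ENNReal.ofReal_one]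
          ring
  obtain ⟨y₀, hy₀⟩ := exists_le_laverage hν0
    (hF.add (hJ.const_mul (ENNReal.ofReal ε * u))).aemeasurable
  have hb : F y₀ + ENNReal.ofReal ε * u * J y₀ ≤ ENNReal.ofReal (ε * (1 + Λ)) * u := by
    refine hy₀.trans ?_
    rw [laverage_eq, hνu]
    exact ENNReal.div_le_of_le_mul htot
  refine ⟨y₀, ?_, ?_⟩
  · refine le_trans (le_of_eq ?_) (le_self_add.trans hb)
    rw [← lintegral_gaussianTilt μ x (by fun_prop)]
    exact lintegral_congr fun y => by rw [norm_sub_rev]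
  · have hk := heatKernel_pos one_pos (x - y₀)
    have h1 : ENNReal.ofReal ε * u * J y₀ ≤ ENNReal.ofReal ε * u * ENNReal.ofReal (1 + Λ) :=
      (le_add_self.trans hb).trans_eq (by rw [ENNReal.ofReal_mul hε.le]; ring)
    have h2 : ((1 + ‖x - y₀‖) ^ L)⁻¹ / heatKernel 1 (x - y₀) ≤ 1 + Λ := by
      have h3 := (ENNReal.mul_le_mul_iff_right (mul_ne_zero (by simpa using hε) hu0)
        (ENNReal.mul_ne_top ENNReal.ofReal_ne_top hut)).1 h1
      exact (ENNReal.ofReal_le_ofReal_iff (by positivity)).1 h3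
    rw [div_le_iff₀ hk, inv_le_iff_one_le_mul₀ (by positivity)] at h2
    linarith

/-- A measure of small spread seen from `x`, translated by some `-y₀` and rescaled, is close to the
Dirac measure at `0`, uniformly on a bounded set of Schwartz functions. The scalar is
`m = k₁(x - y₀) / H[μ](x, 1)`, so that `m ∫ φ(y - y₀) dμ - φ(0)` is `H[μ](x, 1)⁻¹` times the integral
of `ψ(y) = k₁(x - y₀) φ(y - y₀) - φ(0) k₁(x - y)`, which vanishes at `y = y₀`. -/
theorem exists_dirac_close (d L : ℕ) {c Λ ε₀ : ℝ} (hc : 0 < c) (hΛ : 0 ≤ Λ) (hε₀ : 0 < ε₀)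
    (P : ℕ → ℕ → ℝ) :
    ∃ ε : ℝ, 0 < ε ∧ ∀ (μ : Measure (EuclideanSpace ℝ (Fin d))) [SFinite μ]
      (x : EuclideanSpace ℝ (Fin d)), measureHeat μ 1 x ≠ 0 → measureHeat μ 1 x ≠ ∞ →
      ∫⁻ y, ENNReal.ofReal (((1 + ‖x - y‖) ^ L)⁻¹) ∂μ ≤ ENNReal.ofReal Λ * measureHeat μ 1 x →
      spread c μ x ≤ ENNReal.ofReal ε * measureHeat μ 1 x ^ (2 : ℝ) →
      ∃ (m : ℝ) (y₀ : EuclideanSpace ℝ (Fin d)), 0 ≤ m ∧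
        ∀ φ : 𝓢(EuclideanSpace ℝ (Fin d), ℝ), (∀ k n, SchwartzMap.seminorm ℝ k n φ ≤ P k n) →
          Integrable (fun y => φ (y - y₀)) μ ∧ |m * ∫ y, φ (y - y₀) ∂μ - φ 0| < ε₀ := by
  obtain ⟨K₁, hK₁0, hK₁⟩ := exists_one_add_norm_pow_mul_heatKernel_le (d := d) (L + 1)
  obtain ⟨K₂, hK₂0, hK₂⟩ := exists_heatKernel_lipschitz d
  set R : ℝ := (1 + Λ) * K₁ with hR
  set Q : ℝ := 2 ^ (L + 1) * (|P 0 0| + |P (L + 1) 0|) with hQ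
  set A₁ : ℝ := |P 0 1| * K₁ + |P 0 0| * K₂ with hA₁
  set A₂ : ℝ := R ^ (L + 1) * Q * K₁ + |P 0 0| * K₁ with hA₂
  set η : ℝ := ε₀ / (3 * (1 + Λ)) with hη
  have hη0 : 0 < η := by positivity
  obtain ⟨B, hB0, hB⟩ := exists_abs_le_decay_add_spread d L hc hη0 A₁ A₂
  set ε : ℝ := ε₀ / (3 * (1 + Λ) * (1 + B)) with hε
  have hε' : 0 < ε := by positivity
  refine ⟨ε, hε', fun μ _ x hu0 hut hdec hsp => ?_⟩
  obtain ⟨y₀, hy₀, hloc⟩ := exists_center L c hΛ hε' μ x hu0 hut hdec hsp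
  set U := (measureHeat μ 1 x).toReal with hU
  have hU0 : 0 < U := ENNReal.toReal_pos hu0 hut
  have huU : measureHeat μ 1 x = ENNReal.ofReal U := (ENNReal.ofReal_toReal hut).symm
  have hk0 := heatKernel_pos one_pos (x - y₀)
  -- `y₀` stays within a bounded distance of `x`
  have hyR : 1 + ‖x - y₀‖ ≤ R := by
    have h1 := hK₁ (x - y₀)
    rw [pow_succ] at h1
    have h2 : (1 + ‖x - y₀‖) * 1 ≤ (1 + ‖x - y₀‖) *
        ((1 + Λ) * ((1 + ‖x - y₀‖) ^ L * heatKernel 1 (x - y₀))) := by gcongr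
    calc 1 + ‖x - y₀‖ ≤ (1 + Λ) * ((1 + ‖x - y₀‖) ^ L * (1 + ‖x - y₀‖) *
          heatKernel 1 (x - y₀)) := by linarith
      _ ≤ R := by rw [hR]; gcongr
  have hkle : ∀ z : EuclideanSpace ℝ (Fin d), heatKernel 1 z ≤ K₁ := fun z => by
    refine le_trans ?_ (hK₁ z)
    exact le_mul_of_one_le_left (heatKernel_pos one_pos z).le
      (one_le_pow₀ (by linarith [norm_nonneg z]))
  -- `h` is the decaying weight and `g` the weight vanishing only at `y₀`
  let h : EuclideanSpace ℝ (Fin d) → ℝ := fun y => ((1 + ‖x - y‖) ^ L)⁻¹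
  have hhc : Continuous h := Continuous.inv₀ (by fun_prop) fun y => by positivity
  have hh0 : ∀ y, 0 ≤ h y := fun y => by positivity
  have hhint : Integrable h μ := by
    refine ⟨hhc.aestronglyMeasurable, ?_⟩
    rw [hasFiniteIntegral_iff_ofReal (.of_forall hh0)]
    exact hdec.trans_lt (ENNReal.mul_lt_top ENNReal.ofReal_lt_top hut.lt_top)
  have hhle : ∫ y, h y ∂μ ≤ Λ * U := by
    rw [integral_eq_lintegral_of_nonneg_ae (.of_forall hh0) hhc.aestronglyMeasurable]
    refine ENNReal.toReal_le_of_le_ofReal (by positivity) (hdec.trans_eq ?_)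
    rw [huU, ENNReal.ofReal_mul hΛ]
  let g : EuclideanSpace ℝ (Fin d) → ℝ := fun y =>
    (1 - Real.exp (-(c * ‖y - y₀‖ ^ 2))) * heatKernel 1 (x - y)
  have hkc := continuous_heatKernel (d := d) 1
  have hgc : Continuous g := by fun_prop
  have hg0' : ∀ y : EuclideanSpace ℝ (Fin d), 0 ≤ 1 - Real.exp (-(c * ‖y - y₀‖ ^ 2)) := fun y => by
    rw [sub_nonneg, Real.exp_le_one_iff, neg_nonpos]; positivity
  have hg0 : ∀ y, 0 ≤ g y := fun y => mul_nonneg (hg0' y) (heatKernel_pos one_pos _).le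
  have hgl : ∫⁻ y, ENNReal.ofReal (g y) ∂μ ≤
      ENNReal.ofReal (ε * (1 + Λ)) * measureHeat μ 1 x := by
    refine le_trans (le_of_eq (lintegral_congr fun y => ?_)) hy₀
    rw [ennHeatKernel, ← ENNReal.ofReal_mul (hg0' y)]
  have hgint : Integrable g μ := by
    refine ⟨hgc.aestronglyMeasurable, ?_⟩
    rw [hasFiniteIntegral_iff_ofReal (.of_forall hg0)]
    exact hgl.trans_lt (ENNReal.mul_lt_top ENNReal.ofReal_lt_top hut.lt_top)
  have hgle : ∫ y, g y ∂μ ≤ ε * (1 + Λ) * U := by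
    rw [integral_eq_lintegral_of_nonneg_ae (.of_forall hg0) hgc.aestronglyMeasurable]
    refine ENNReal.toReal_le_of_le_ofReal (by positivity) (hgl.trans_eq ?_)
    rw [huU, ← ENNReal.ofReal_mul (by positivity)]
  have hkint : Integrable (fun y => heatKernel 1 (x - y)) μ := by
    refine ⟨(hkc.comp (by fun_prop)).aestronglyMeasurable, ?_⟩
    rw [hasFiniteIntegral_iff_ofReal (.of_forall fun y => (heatKernel_pos one_pos _).le)]
    exact hut.lt_top
  have hkU : ∫ y, heatKernel 1 (x - y) ∂μ = U := by
    rw [integral_eq_lintegral_of_nonneg_ae (.of_forall fun y => (heatKernel_pos one_pos _).le)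
      (hkc.comp (by fun_prop)).aestronglyMeasurable]
    rfl
  refine ⟨heatKernel 1 (x - y₀) / U, y₀, by positivity, fun φ hφ => ?_⟩
  have hφ0 : ∀ z, |φ z| ≤ |P 0 0| := fun z =>
    (φ.norm_le_seminorm ℝ z).trans ((hφ 0 0).trans (le_abs_self _))
  have hφdec : ∀ y, (1 + ‖x - y‖) ^ (L + 1) * |φ (y - y₀)| ≤ R ^ (L + 1) * Q := fun y => by
    have h1 : (1 + ‖x - y‖) ≤ R * (1 + ‖y - y₀‖) := by
      have h2 : ‖x - y‖ ≤ ‖x - y₀‖ + ‖y - y₀‖ := by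
        rw [norm_sub_rev y y₀]; exact norm_sub_le_norm_sub_add_norm_sub x y₀ y
      have := norm_nonneg (y - y₀)
      have := norm_nonneg (x - y₀)
      nlinarith
    have h3 := φ.one_add_norm_pow_mul_abs_le hφ (L + 1) (y - y₀)
    have hR0 : 0 ≤ R := by positivity
    calc (1 + ‖x - y‖) ^ (L + 1) * |φ (y - y₀)|
        ≤ (R * (1 + ‖y - y₀‖)) ^ (L + 1) * |φ (y - y₀)| := by gcongr
      _ = R ^ (L + 1) * ((1 + ‖y - y₀‖) ^ (L + 1) * |φ (y - y₀)|) := by rw [mul_pow]; ring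
      _ ≤ R ^ (L + 1) * Q := by
        refine mul_le_mul_of_nonneg_left (h3.trans ?_) (by positivity)
        rw [hQ]
        gcongr <;> exact le_abs_self _
  have hφc : Continuous fun y => φ (y - y₀) := φ.continuous.comp (by fun_prop)
  have hφint : Integrable (fun y => φ (y - y₀)) μ := by
    refine (hhint.const_mul (R ^ (L + 1) * Q)).mono' hφc.aestronglyMeasurable
      (.of_forall fun y => ?_)
    have h1 := hφdec y
    rw [Real.norm_eq_abs, ← div_eq_mul_inv, le_div_iff₀ (by positivity)]
    refine le_trans ?_ h1
    rw [mul_comm]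
    refine mul_le_mul_of_nonneg_right (pow_le_pow_right₀ ?_ (by omega)) (abs_nonneg _)
    linarith [norm_nonneg (x - y)]
  refine ⟨hφint, ?_⟩
  let ψ : EuclideanSpace ℝ (Fin d) → ℝ := fun y =>
    heatKernel 1 (x - y₀) * φ (y - y₀) - φ 0 * heatKernel 1 (x - y)
  have hψle : ∀ y, |ψ y| ≤ η * h y + B * g y := fun y => by
    refine hB x y₀ y (ψ y) ?_ ?_
    · have e : ψ y = heatKernel 1 (x - y₀) * (φ (y - y₀) - φ 0) +
          φ 0 * (heatKernel 1 (x - y₀) - heatKernel 1 (x - y)) := by simp only [ψ]; ring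
      have h1 : |φ (y - y₀) - φ 0| ≤ |P 0 1| * ‖y - y₀‖ := by
        have := φ.abs_sub_le_seminorm (y - y₀) 0
        rw [sub_zero] at this
        exact this.trans (by gcongr; exact (hφ 0 1).trans (le_abs_self _))
      have h2 : |heatKernel 1 (x - y₀) - heatKernel 1 (x - y)| ≤ K₂ * ‖y - y₀‖ := by
        simpa using hK₂ (x - y₀) (x - y)
      rw [e]
      refine (abs_add_le _ _).trans ?_
      rw [abs_mul, abs_mul, abs_of_pos hk0, hA₁, add_mul]
      refine add_le_add ?_ ?_
      · calc _ ≤ K₁ * (|P 0 1| * ‖y - y₀‖) := by gcongr; exact hkle _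
          _ = _ := by ring
      · calc _ ≤ |P 0 0| * (K₂ * ‖y - y₀‖) :=
            mul_le_mul (hφ0 0) h2 (abs_nonneg _) (abs_nonneg _)
          _ = _ := by ring
    · have hk := heatKernel_pos one_pos (x - y)
      have h1 : |ψ y| ≤ |φ (y - y₀)| * K₁ + |P 0 0| * heatKernel 1 (x - y) := by
        refine (abs_sub _ _).trans ?_
        rw [abs_mul, abs_mul, abs_of_pos hk0, abs_of_pos hk, mul_comm]
        exact add_le_add (mul_le_mul_of_nonneg_left (hkle _) (abs_nonneg _))
          (mul_le_mul_of_nonneg_right (hφ0 0) hk.le)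
      calc (1 + ‖x - y‖) ^ (L + 1) * |ψ y|
          ≤ (1 + ‖x - y‖) ^ (L + 1) * (|φ (y - y₀)| * K₁ + |P 0 0| * heatKernel 1 (x - y)) := by
            gcongr
        _ = (1 + ‖x - y‖) ^ (L + 1) * |φ (y - y₀)| * K₁ +
            |P 0 0| * ((1 + ‖x - y‖) ^ (L + 1) * heatKernel 1 (x - y)) := by ring
        _ ≤ A₂ := by
            rw [hA₂]
            exact add_le_add (mul_le_mul_of_nonneg_right (hφdec y) hK₁0.le)
              (mul_le_mul_of_nonneg_left (hK₁ _) (abs_nonneg _))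
  have hψint : ∫ y, ψ y ∂μ = heatKernel 1 (x - y₀) * ∫ y, φ (y - y₀) ∂μ - φ 0 * U := by
    simp only [ψ]
    rw [integral_sub (hφint.const_mul _) (hkint.const_mul _), integral_const_mul,
      integral_const_mul, hkU]
  have habs : |∫ y, ψ y ∂μ| ≤ η * (Λ * U) + B * (ε * (1 + Λ) * U) := by
    calc |∫ y, ψ y ∂μ| ≤ ∫ y, |ψ y| ∂μ := abs_integral_le_integral_abs
      _ ≤ ∫ y, (η * h y + B * g y) ∂μ := by
        refine integral_mono_of_nonneg (.of_forall fun y => abs_nonneg _)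
          ((hhint.const_mul _).add (hgint.const_mul _)) (.of_forall hψle)
      _ = η * ∫ y, h y ∂μ + B * ∫ y, g y ∂μ := by
        rw [integral_add (hhint.const_mul _) (hgint.const_mul _), integral_const_mul,
          integral_const_mul]
      _ ≤ _ := by gcongr
  have hfinal : heatKernel 1 (x - y₀) / U * ∫ y, φ (y - y₀) ∂μ - φ 0 = (∫ y, ψ y ∂μ) / U := by
    rw [hψint]; field_simp
  rw [hfinal, abs_div, abs_of_pos hU0, div_lt_iff₀ hU0]
  refine habs.trans_lt ?_
  have e1 : η * Λ ≤ ε₀ / 3 := by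
    rw [hη, div_mul_eq_mul_div, div_le_div_iff₀ (by positivity) (by norm_num)]
    nlinarith
  have e2 : B * (ε * (1 + Λ)) ≤ ε₀ / 3 := by
    rw [hε]
    have : B * (ε₀ / (3 * (1 + Λ) * (1 + B)) * (1 + Λ)) = ε₀ / 3 * (B / (1 + B)) := by
      field_simp
    rw [this]
    refine mul_le_of_le_one_right (by positivity) ?_
    rw [div_le_one (by positivity)]; linarith
  calc η * (Λ * U) + B * (ε * (1 + Λ) * U) = (η * Λ + B * (ε * (1 + Λ))) * U := by ring
    _ ≤ (ε₀ / 3 + ε₀ / 3) * U := by gcongr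
    _ < ε₀ * U := by gcongr; linarith

/-! ### A lower bound for the averaged spread -/

/-- A weight whose values at two points are comparable up to a polynomial in their distance. -/
structure IsModerateWeight {d : ℕ} (C : ℝ) (N : ℕ) (w : EuclideanSpace ℝ (Fin d) → ℝ≥0∞) :
    Prop where
  measurable : Measurable w
  le_mul : ∀ x y, w x ≤ ENNReal.ofReal (C * (1 + ‖x - y‖) ^ N) * w y

/-- The function `(1 + |z|)^{-N}` with values in `[0,∞]`. -/
noncomputable def polyDecay {d : ℕ} (N : ℕ) (z : EuclideanSpace ℝ (Fin d)) : ℝ≥0∞ :=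
  ENNReal.ofReal (((1 + ‖z‖) ^ N)⁻¹)

theorem measurable_polyDecay {d : ℕ} (N : ℕ) :
    Measurable (polyDecay N : EuclideanSpace ℝ (Fin d) → ℝ≥0∞) := by
  have h1 : Continuous fun y : EuclideanSpace ℝ (Fin d) => ((1 + ‖y‖) ^ N)⁻¹ :=
    Continuous.inv₀ (by fun_prop) fun y => by positivity
  exact h1.measurable.ennreal_ofReal

theorem polyDecay_mul_le {d : ℕ} (N : ℕ) (a b : EuclideanSpace ℝ (Fin d)) :
    polyDecay N a * polyDecay N b ≤ polyDecay N (a + b) := by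
  unfold polyDecay
  rw [← ENNReal.ofReal_mul (by positivity), ← mul_inv, ← mul_pow]
  apply ENNReal.ofReal_le_ofReal
  gcongr
  have := norm_add_le a b
  nlinarith [norm_nonneg a, norm_nonneg b]

theorem polyDecay_neg {d : ℕ} (N : ℕ) (a : EuclideanSpace ℝ (Fin d)) :
    polyDecay N (-a) = polyDecay N a := by simp [polyDecay]

theorem lintegral_polyDecay_lt_top {d N : ℕ} (hN : d < N) :
    ∫⁻ z : EuclideanSpace ℝ (Fin d), polyDecay N z < ∞ := by
  have h := finite_integral_one_add_norm (μ := (volume : Measure (EuclideanSpace ℝ (Fin d))))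
    (r := N) (by simpa using hN)
  refine lt_of_eq_of_lt (lintegral_congr fun z => ?_) h
  rw [polyDecay, Real.rpow_neg (by positivity), Real.rpow_natCast]

/-- Up to a constant, integrating a polynomially decaying function against the heat extension
controls its integral against the measure itself. -/
theorem lintegral_polyDecay_le {d : ℕ} (N : ℕ) (μ : Measure (EuclideanSpace ℝ (Fin d))) [SFinite μ]
    (x : EuclideanSpace ℝ (Fin d)) :
    (∫⁻ z : EuclideanSpace ℝ (Fin d), ennHeatKernel 1 z * polyDecay N z) *
      ∫⁻ y, polyDecay N (x - y) ∂μ ≤ ∫⁻ z, measureHeat μ 1 z * polyDecay N (z - x) := by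
  have hk := measurable_ennHeatKernel (d := d) 1
  have hp := measurable_polyDecay (d := d) N
  have e1 : ∀ z, measureHeat μ 1 z * polyDecay N (z - x) =
      ∫⁻ y, ennHeatKernel 1 (z - y) * polyDecay N (z - x) ∂μ := fun z => by
    rw [measureHeat, lintegral_mul_const _ (measurable_ennHeatKernel_sub 1 z)]
  simp_rw [e1]
  rw [lintegral_lintegral_swap (Measurable.aemeasurable ((hk.comp measurable_sub).mul
    (hp.comp (measurable_fst.sub measurable_const))))]
  have hpx : Measurable fun y => polyDecay N (x - y) := hp.comp (measurable_const.sub measurable_id)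
  rw [← lintegral_const_mul _ hpx]
  refine lintegral_mono fun y => ?_
  have e2 := lintegral_sub_right_eq_self (μ := (volume : Measure (EuclideanSpace ℝ (Fin d))))
    (fun z => ennHeatKernel 1 z * polyDecay N z) y
  have hm : Measurable fun z => ennHeatKernel 1 (z - y) * polyDecay N (z - y) :=
    (hk.mul hp).comp (measurable_id.sub measurable_const)
  dsimp only
  rw [← e2, ← lintegral_mul_const _ hm]
  refine lintegral_mono fun z => ?_
  rw [mul_assoc]
  gcongr
  rw [← polyDecay_neg N (x - y), neg_sub]
  exact (polyDecay_mul_le N _ _).trans_eq (by rw [sub_add_sub_cancel])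

theorem lintegral_mul_le_of_lintegral_rpow_mul_le {α : Type*} [MeasurableSpace α] (m : Measure α)
    {u h : α → ℝ≥0∞} (hu : Measurable u) (hh : Measurable h) {p : ℝ} (hp : 1 < p) {A v : ℝ≥0∞}
    (H : ∫⁻ x, u x ^ p * h x ∂m ≤ A * v ^ p) :
    ∫⁻ x, u x * h x ∂m ≤ A ^ (1 / p) * (∫⁻ x, h x ∂m) ^ (1 - 1 / p) * v := by
  have hp0 : 0 < p := by linarith
  have hq : 0 ≤ 1 - 1 / p := by rw [sub_nonneg, div_le_one hp0]; exact hp.le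
  have hcancel : ∀ a : ℝ≥0∞, (a ^ p) ^ (1 / p) = a := fun a => by
    rw [← ENNReal.rpow_mul, mul_one_div_cancel hp0.ne', ENNReal.rpow_one]
  have h1 := ENNReal.lintegral_mul_norm_pow_le (μ := m) ((hu.pow_const p).mul hh).aemeasurable
    hh.aemeasurable (p := 1 / p) (q := 1 - 1 / p) (by positivity) hq (by ring)
  have e : ∀ x, (u x ^ p * h x) ^ (1 / p) * h x ^ (1 - 1 / p) = u x * h x := fun x => by
    rw [ENNReal.mul_rpow_of_nonneg _ _ (by positivity), hcancel, mul_assoc,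
      ← ENNReal.rpow_add_of_nonneg _ _ (by positivity) hq, add_sub_cancel, ENNReal.rpow_one]
  simp only [Pi.mul_apply, e] at h1
  refine h1.trans ?_
  rw [mul_right_comm]
  gcongr
  refine (ENNReal.rpow_le_rpow H (by positivity)).trans_eq ?_
  rw [ENNReal.mul_rpow_of_nonneg _ _ (by positivity), hcancel]

/-- If `n ∫ g < ∫ f`, then at some point `x` both `n g(x)` and a polynomially weighted integral of
`f` centred at `x` are bounded by a multiple of `f(x)`: otherwise integrate the reverse inequality. -/
theorem exists_mul_add_lintegral_polyDecay_lt {d m : ℕ} (hm : d < m)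
    {f g : EuclideanSpace ℝ (Fin d) → ℝ≥0∞} (hf : Measurable f) (hg : Measurable g) {n : ℝ≥0∞}
    (hfi : ∫⁻ x, f x ≠ ∞) (hgf : n * ∫⁻ x, g x < ∫⁻ x, f x) :
    ∃ x, f x ≠ ∞ ∧ n * g x + ∫⁻ z, f z * polyDecay m (z - x) <
      (1 + ∫⁻ z : EuclideanSpace ℝ (Fin d), polyDecay m z) * f x := by
  have hp := measurable_polyDecay (d := d) m
  set κ := ∫⁻ z : EuclideanSpace ℝ (Fin d), polyDecay m z with hκ
  have hκt : κ < ∞ := lintegral_polyDecay_lt_top hm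
  have hswap : ∫⁻ x, ∫⁻ z, f z * polyDecay m (z - x) = κ * ∫⁻ x, f x := by
    rw [lintegral_lintegral_swap (Measurable.aemeasurable ((hf.comp measurable_snd).mul
      (hp.comp (measurable_snd.sub measurable_fst))))]
    have e : ∀ z, ∫⁻ x, f z * polyDecay m (z - x) = κ * f z := fun z => by
      have hpx : Measurable fun x => polyDecay m (z - x) :=
        hp.comp (measurable_const.sub measurable_id)
      rw [lintegral_const_mul _ hpx, lintegral_sub_left_eq_self (fun x => polyDecay m x) z, mul_comm]
    simp_rw [e]
    rw [lintegral_const_mul _ hf]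
  by_contra! hcon
  have hae : ∀ᵐ x, (1 + κ) * f x ≤ n * g x + ∫⁻ z, f z * polyDecay m (z - x) := by
    filter_upwards [ae_lt_top hf hfi] with x hx using hcon x hx.ne
  have h := lintegral_mono_ae hae
  rw [lintegral_const_mul _ hf, lintegral_add_left (hg.const_mul _), lintegral_const_mul _ hg,
    hswap, add_mul, one_mul] at h
  refine absurd h (not_le.2 ?_)
  exact ENNReal.add_lt_add_right (ENNReal.mul_ne_top hκt.ne hfi) hgf

theorem RealTemperedDistribution.IsRepresentedBy.measureHeat_ne_top {d : ℕ}
    {T : RealTemperedDistribution d} {μ : Measure (EuclideanSpace ℝ (Fin d))}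
    (h : T.IsRepresentedBy μ) {t : ℝ} (ht : 0 < t) (x : EuclideanSpace ℝ (Fin d)) :
    measureHeat μ t x ≠ ∞ := by
  have h1 := h.integrable_of_nonneg (schwartzHeatKernel t x) fun y => by
    rw [schwartzHeatKernel_apply t ht]; exact (heatKernel_pos ht _).le
  have h2 := (hasFiniteIntegral_iff_ofReal (.of_forall fun y => by
    rw [schwartzHeatKernel_apply t ht]; exact (heatKernel_pos ht _).le)).1 h1.2
  simp_rw [schwartzHeatKernel_apply t ht] at h2
  exact h2.ne

theorem RealTemperedDistribution.IsRepresentedBy.ofReal_heat {d : ℕ}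
    {T : RealTemperedDistribution d} {μ : Measure (EuclideanSpace ℝ (Fin d))}
    (h : T.IsRepresentedBy μ) {t : ℝ} (ht : 0 < t) (x : EuclideanSpace ℝ (Fin d)) :
    ENNReal.ofReal (T.heat x t) = measureHeat μ t x := by
  have h0 : ∀ y, 0 ≤ schwartzHeatKernel t x y := fun y => by
    rw [schwartzHeatKernel_apply t ht]; exact (heatKernel_pos ht _).le
  have h1 := h.integrable_of_nonneg (schwartzHeatKernel t x) h0
  rw [RealTemperedDistribution.heat, h.apply_eq_integral _ h1,
    ofReal_integral_eq_lintegral_ofReal h1 (.of_forall h0)]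
  simp_rw [schwartzHeatKernel_apply t ht]
  rfl

theorem lintegral_heatKernel_mul_polyDecay_pos (d N : ℕ) :
    (∫⁻ z : EuclideanSpace ℝ (Fin d), ennHeatKernel 1 z * polyDecay N z) ≠ 0 := by
  intro h
  have hm : Measurable fun z : EuclideanSpace ℝ (Fin d) => ennHeatKernel 1 z * polyDecay N z :=
    (measurable_ennHeatKernel 1).mul (measurable_polyDecay N)
  rw [lintegral_eq_zero_iff hm] at h
  have hall : ∀ z : EuclideanSpace ℝ (Fin d), ennHeatKernel 1 z * polyDecay N z ≠ 0 := fun z => by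
    refine mul_ne_zero ?_ ?_
    · simpa [ennHeatKernel] using heatKernel_pos one_pos z
    · simp only [polyDecay, ne_eq, ENNReal.ofReal_eq_zero, not_le]; positivity
  have : (volume : Measure (EuclideanSpace ℝ (Fin d))) Set.univ = 0 :=
    measure_mono_null (fun z _ => hall z) (ae_iff.1 h)
  exact NeZero.ne _ (Measure.measure_univ_eq_zero.1 this)

/-- Averaged against moderate weights, the spread of the measures of an invariant cone without Dirac
measures is bounded below. Otherwise there is a point `x` at which the spread of some `μ` is small,
while the weighted integral of `H[μ](·, 1) ^ p` controls the growth of `μ` around `x`, and by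
`exists_dirac_close` a translate and multiple of `μ` is too close to the Dirac measure. -/
theorem exists_mul_lintegral_le_lintegral_spread {d : ℕ} {M : Set (RealTemperedDistribution d)}
    (hM : IsInvariantConeOfMeasures M) (hδ : RealTemperedDistribution.dirac 0 ∉ M)
    (C : ℝ) (N : ℕ) {p c : ℝ} (hp : 1 < p) (hc : 0 < c) :
    ∃ c₀ : ℝ, 0 < c₀ ∧ ∀ T ∈ M, ∀ μ, T.IsRepresentedBy μ →
      ∀ w, IsModerateWeight C N w → ∫⁻ x, measureHeat μ 1 x ^ p * w x ≠ ∞ →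
        ENNReal.ofReal c₀ * ∫⁻ x, measureHeat μ 1 x ^ p * w x ≤
          ∫⁻ x, spread c μ x * measureHeat μ 1 x ^ (p - 2) * w x := by
  have hp0 : 0 < p := by linarith
  obtain ⟨P, ε₀, hε₀, hsep⟩ := exists_bounded_separating_dirac hM.isClosed hδ
  set m := d + 1 with hm
  set L := m + N with hL
  set κ := ∫⁻ z : EuclideanSpace ℝ (Fin d), polyDecay m z with hκ
  set κ' := ∫⁻ z : EuclideanSpace ℝ (Fin d), polyDecay L z with hκ'
  set c₁ := ∫⁻ z : EuclideanSpace ℝ (Fin d), ennHeatKernel 1 z * polyDecay L z with hc₁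
  have hκt : κ < ∞ := lintegral_polyDecay_lt_top (by omega)
  have hκt' : κ' < ∞ := lintegral_polyDecay_lt_top (by omega)
  have hc₁0 : c₁ ≠ 0 := lintegral_heatKernel_mul_polyDecay_pos d L
  have hc₁t : c₁ ≠ ∞ := by
    refine ne_top_of_le_ne_top ENNReal.one_ne_top (le_trans (lintegral_mono fun z => ?_)
      (lintegral_heatKernel (d := d) one_pos).le)
    refine mul_le_of_le_one_right zero_le ?_
    rw [polyDecay, ENNReal.ofReal_le_one]
    exact inv_le_one_of_one_le₀ (one_le_pow₀ (by linarith [norm_nonneg z]))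
  set A : ℝ≥0∞ := ENNReal.ofReal C * (1 + κ) with hA
  have hAt : A ≠ ∞ := ENNReal.mul_ne_top ENNReal.ofReal_ne_top (by simp [hκt.ne])
  set C₂ : ℝ≥0∞ := A ^ (1 / p) * κ' ^ (1 - 1 / p) with hC₂
  have hq : 0 ≤ 1 - 1 / p := by rw [sub_nonneg, div_le_one hp0]; exact hp.le
  have hC₂t : C₂ ≠ ∞ := ENNReal.mul_ne_top (ENNReal.rpow_ne_top_of_nonneg (by positivity) hAt)
    (ENNReal.rpow_ne_top_of_nonneg hq hκt'.ne)
  obtain ⟨ε, hε, hclose⟩ := exists_dirac_close d L hc (Λ := (C₂ / c₁).toReal)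
    ENNReal.toReal_nonneg hε₀ P
  refine ⟨ε / (1 + κ.toReal), by positivity, fun T hT μ hμ w hw hfin => ?_⟩
  have := hμ.isFiniteMeasureOnCompacts
  have hu := measurable_measureHeat μ 1
  have hut : ∀ x, measureHeat μ 1 x ≠ ∞ := hμ.measureHeat_ne_top one_pos
  by_contra! hcon
  set c₀ : ℝ≥0∞ := ENNReal.ofReal (ε / (1 + κ.toReal)) with hc₀
  have hc₀0 : c₀ ≠ 0 := by rw [hc₀]; simp only [ne_eq, ENNReal.ofReal_eq_zero, not_le]; positivity
  have hc₀t : c₀ ≠ ∞ := ENNReal.ofReal_ne_top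
  have hc₀κ : c₀ * (1 + κ) = ENNReal.ofReal ε := by
    have : (1 + κ) = ENNReal.ofReal (1 + κ.toReal) := by
      rw [ENNReal.ofReal_add zero_le_one ENNReal.toReal_nonneg, ENNReal.ofReal_toReal hκt.ne,
        ENNReal.ofReal_one]
    rw [this, hc₀, ← ENNReal.ofReal_mul (by positivity), div_mul_cancel₀ _ (by positivity)]
  obtain ⟨x, hfx, hx⟩ := exists_mul_add_lintegral_polyDecay_lt (m := m) (by omega)
    (f := fun x => measureHeat μ 1 x ^ p * w x)
    (g := fun x => spread c μ x * measureHeat μ 1 x ^ (p - 2) * w x) (n := c₀⁻¹)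
    ((hu.pow_const p).mul hw.measurable)
    (((measurable_spread c μ).mul (hu.pow_const _)).mul hw.measurable) hfin (by
      rw [← ENNReal.div_eq_inv_mul]
      exact ENNReal.div_lt_of_lt_mul' hcon)
  rw [← hκ] at hx
  set u := measureHeat μ 1 x with hux
  have hut' : u ≠ ∞ := hut x
  have hf0 : u ^ p * w x ≠ 0 := fun h => by rw [h, mul_zero] at hx; exact not_lt_zero hx
  have hu0 : u ≠ 0 := fun h => hf0 (by rw [h, ENNReal.zero_rpow_of_pos hp0, zero_mul])
  have hw0 : w x ≠ 0 := right_ne_zero_of_mul hf0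
  have hup0 : u ^ p ≠ 0 := left_ne_zero_of_mul hf0
  have hwt : w x ≠ ∞ := fun h => hfx (by rw [h, ENNReal.mul_top hup0])
  -- the spread of `μ` at `x` is small
  have hsp : spread c μ x ≤ ENNReal.ofReal ε * u ^ (2 : ℝ) := by
    have h1 : c₀⁻¹ * (spread c μ x * u ^ (p - 2) * w x) ≤ (1 + κ) * (u ^ p * w x) :=
      le_self_add.trans hx.le
    have h2 : spread c μ x * (u ^ (p - 2) * w x) ≤
        ENNReal.ofReal ε * u ^ (2 : ℝ) * (u ^ (p - 2) * w x) := by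
      have h3 := mul_le_mul_right h1 c₀
      rw [← mul_assoc, ENNReal.mul_inv_cancel hc₀0 hc₀t, one_mul, ← mul_assoc c₀, hc₀κ] at h3
      have e : u ^ p = u ^ (2 : ℝ) * u ^ (p - 2) := by
        rw [← ENNReal.rpow_add _ _ hu0 (hut x)]; congr 1; ring
      rw [e] at h3
      calc _ = spread c μ x * u ^ (p - 2) * w x := by ring
        _ ≤ _ := h3
        _ = _ := by ring
    refine (ENNReal.mul_le_mul_iff_left (mul_ne_zero ?_ hw0) (ENNReal.mul_ne_top ?_ hwt)).1 h2
    · simp [ENNReal.rpow_eq_zero_iff, hu0, hut']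
    · simp [ENNReal.rpow_eq_top_iff, hu0, hut']
  -- the measure has bounded polynomial growth around `x`
  have hup : ∫⁻ z, measureHeat μ 1 z ^ p * polyDecay L (z - x) ≤ A * u ^ p := by
    have h1 : ∫⁻ z, measureHeat μ 1 z ^ p * w z * polyDecay m (z - x) ≤ (1 + κ) * (u ^ p * w x) :=
      le_add_self.trans hx.le
    have hmz : ∀ k, Measurable fun z => polyDecay k (z - x) := fun k =>
      (measurable_polyDecay k).comp (measurable_id.sub measurable_const)
    have h2 : w x * ∫⁻ z, measureHeat μ 1 z ^ p * polyDecay L (z - x) ≤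
        ENNReal.ofReal C * ∫⁻ z, measureHeat μ 1 z ^ p * w z * polyDecay m (z - x) := by
      rw [← lintegral_const_mul' _ _ hwt, ← lintegral_const_mul' _ _ ENNReal.ofReal_ne_top]
      refine lintegral_mono fun z => ?_
      have h3 : w x * polyDecay L (z - x) ≤ ENNReal.ofReal C * (w z * polyDecay m (z - x)) := by
        have h4 : ENNReal.ofReal (C * (1 + ‖x - z‖) ^ N) * polyDecay L (z - x) =
            ENNReal.ofReal C * polyDecay m (z - x) := by
          rw [polyDecay, polyDecay, norm_sub_rev z x,
            ENNReal.ofReal_mul' (by positivity), mul_assoc, ← ENNReal.ofReal_mul (by positivity)]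
          congr 2
          rw [hL, pow_add]
          have : (1 + ‖x - z‖) ≠ 0 := by positivity
          field_simp
        calc _ ≤ ENNReal.ofReal (C * (1 + ‖x - z‖) ^ N) * w z * polyDecay L (z - x) := by
              gcongr; exact hw.le_mul x z
          _ = (ENNReal.ofReal (C * (1 + ‖x - z‖) ^ N) * polyDecay L (z - x)) * w z := by ring
          _ = _ := by rw [h4]; ring
      calc _ = measureHeat μ 1 z ^ p * (w x * polyDecay L (z - x)) := by ring
        _ ≤ measureHeat μ 1 z ^ p * (ENNReal.ofReal C * (w z * polyDecay m (z - x))) := by gcongr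
        _ = _ := by ring
    refine (ENNReal.mul_le_mul_iff_right hw0 hwt).1 (h2.trans ?_)
    calc _ ≤ ENNReal.ofReal C * ((1 + κ) * (u ^ p * w x)) := by gcongr
      _ = _ := by rw [hA]; ring
  have hdec : ∫⁻ y, ENNReal.ofReal (((1 + ‖x - y‖) ^ L)⁻¹) ∂μ ≤
      ENNReal.ofReal (C₂ / c₁).toReal * u := by
    have h1 := lintegral_mul_le_of_lintegral_rpow_mul_le volume hu
      (h := fun z => polyDecay L (z - x))
      ((measurable_polyDecay L).comp (measurable_id.sub measurable_const)) hp hup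
    rw [lintegral_sub_right_eq_self (fun z => polyDecay L z) x] at h1
    have h2 := (lintegral_polyDecay_le L μ x).trans h1
    rw [ENNReal.ofReal_toReal (ENNReal.div_ne_top hC₂t hc₁0)]
    refine (ENNReal.mul_le_mul_iff_right hc₁0 hc₁t).1 (h2.trans_eq ?_)
    rw [← mul_assoc, ENNReal.mul_div_cancel hc₁0 hc₁t]
  obtain ⟨a, y₀, ha, hy₀⟩ := hclose μ x hu0 (hut x) hdec hsp
  have hmem : a • T.translate (-y₀) ∈ M := hM.smul_mem _ (hM.translate_mem T hT _) a ha
  obtain ⟨φ, hφ, hφT⟩ := hsep _ hmem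
  obtain ⟨hint, hlt⟩ := hy₀ φ hφ
  refine absurd hlt (not_lt.2 (hφT.trans_eq ?_))
  have e1 : T (SchwartzMap.compSubConstCLM ℝ y₀ φ) = ∫ y, φ (y - y₀) ∂μ := by
    refine (hμ.apply_eq_integral _ ?_).trans ?_
    · exact hint
    · rfl
  have e2 : (a • T.translate (-y₀)) φ = a * T (SchwartzMap.compSubConstCLM ℝ (- -y₀) φ) := rfl
  rw [e2, neg_neg, e1]

/-! ### Iteration over dyadic times -/

theorem RealTemperedDistribution.IsRepresentedBy.sFinite {d : ℕ}
    {T : RealTemperedDistribution d} {μ : Measure (EuclideanSpace ℝ (Fin d))}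
    (h : T.IsRepresentedBy μ) : SFinite μ := by
  have := h.isFiniteMeasureOnCompacts
  infer_instance

theorem RealTemperedDistribution.IsRepresentedBy.dilate {d : ℕ}
    {T : RealTemperedDistribution d} {μ : Measure (EuclideanSpace ℝ (Fin d))}
    (h : T.IsRepresentedBy μ) {r : ℝ} (hr : r ≠ 0) :
    (T.dilate r hr).IsRepresentedBy (μ.map (r • ·)) := by
  have hme : MeasurableEmbedding fun x : EuclideanSpace ℝ (Fin d) => r • x :=
    (Homeomorph.smulOfNeZero r hr).measurableEmbedding
  let Φ : 𝓢(EuclideanSpace ℝ (Fin d), ℝ) → 𝓢(EuclideanSpace ℝ (Fin d), ℝ) :=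
    SchwartzMap.compCLMOfContinuousLinearEquiv ℝ
      (ContinuousLinearEquiv.smulLeft (R₁ := ℝ) (M₁ := EuclideanSpace ℝ (Fin d)) (Units.mk0 r hr))
  have hΦ : ∀ φ x, Φ φ x = φ (r • x) := fun φ x => rfl
  have hint : ∀ φ : 𝓢(EuclideanSpace ℝ (Fin d), ℝ),
      Integrable φ (μ.map (r • ·)) ↔ Integrable (Φ φ) μ := fun φ => hme.integrable_map_iff
  refine ⟨⟨fun K hK => ?_⟩, fun φ hφ => ?_, fun φ hφ => ?_⟩
  · have := h.isFiniteMeasureOnCompacts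
    rw [hme.map_apply]
    exact ((Homeomorph.smulOfNeZero r hr).isClosedEmbedding.isCompact_preimage hK).measure_lt_top
  · rw [hme.integral_map]
    exact h.apply_eq_integral _ ((hint φ).1 hφ)
  · exact (hint φ).2 (h.integrable_of_nonneg _ fun x => hφ _)

/-- The heat extension of a weight, with values in `[0,∞]`. -/
noncomputable def weightHeat {d : ℕ} (w : EuclideanSpace ℝ (Fin d) → ℝ≥0∞) (t : ℝ)
    (x : EuclideanSpace ℝ (Fin d)) : ℝ≥0∞ :=
  ∫⁻ y, w y * ennHeatKernel t (x - y)

theorem ennHeatKernel_sub_comm {d : ℕ} (t : ℝ) (x y : EuclideanSpace ℝ (Fin d)) :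
    ennHeatKernel t (x - y) = ennHeatKernel t (y - x) := by
  rw [ennHeatKernel, heatKernel_sub_comm, ennHeatKernel]

/-- The heat semigroup is symmetric. -/
theorem lintegral_mul_weightHeat {d : ℕ} {f w : EuclideanSpace ℝ (Fin d) → ℝ≥0∞}
    (hf : Measurable f) (hw : Measurable w) (t : ℝ) :
    ∫⁻ z, f z * weightHeat w t z = ∫⁻ x, (∫⁻ z, f z * ennHeatKernel t (x - z)) * w x := by
  have hk := measurable_ennHeatKernel (d := d) t
  have e : ∀ z, f z * weightHeat w t z = ∫⁻ x, f z * (w x * ennHeatKernel t (z - x)) := fun z => by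
    have hm : Measurable fun x => w x * ennHeatKernel t (z - x) :=
      hw.mul (measurable_ennHeatKernel_sub t z)
    rw [weightHeat, lintegral_const_mul _ hm]
  simp_rw [e]
  rw [lintegral_lintegral_swap (Measurable.aemeasurable ((hf.comp measurable_fst).mul
    ((hw.comp measurable_snd).mul (hk.comp measurable_sub))))]
  refine lintegral_congr fun x => ?_
  have hm : Measurable fun z => f z * ennHeatKernel t (x - z) :=
    hf.mul (measurable_ennHeatKernel_sub t x)
  rw [← lintegral_mul_const _ hm]
  exact lintegral_congr fun z => by rw [ennHeatKernel_sub_comm t z x]; ring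

theorem measurable_weightHeat {d : ℕ} {w : EuclideanSpace ℝ (Fin d) → ℝ≥0∞} (hw : Measurable w)
    (t : ℝ) : Measurable (weightHeat w t) :=
  Measurable.lintegral_prod_right' (f := fun q : EuclideanSpace ℝ (Fin d) ×
    EuclideanSpace ℝ (Fin d) => w q.2 * ennHeatKernel t (q.1 - q.2))
    ((hw.comp measurable_snd).mul ((measurable_ennHeatKernel t).comp measurable_sub))

theorem weightHeat_weightHeat {d : ℕ} {w : EuclideanSpace ℝ (Fin d) → ℝ≥0∞} (hw : Measurable w)
    {s t : ℝ} (hs : 0 < s) (ht : 0 < t) (x : EuclideanSpace ℝ (Fin d)) :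
    weightHeat (weightHeat w s) t x = weightHeat w (s + t) x := by
  have hk := measurable_ennHeatKernel_sub (d := d) t x
  have h := lintegral_mul_weightHeat hk hw s
  have e : ∀ v, ∫⁻ z, ennHeatKernel t (x - z) * ennHeatKernel s (v - z) =
      ennHeatKernel (s + t) (x - v) := fun v => by
    have e2 : ∀ z, ennHeatKernel t (x - z) * ennHeatKernel s (v - z) =
        ennHeatKernel (s + t) (x - v) *
          ennHeatKernel (s * t / (s + t)) (z - (s + t)⁻¹ • (t • v + s • x)) := fun z => by
      rw [mul_comm, ennHeatKernel_sub_comm s]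
      simp only [ennHeatKernel]
      rw [← ENNReal.ofReal_mul (heatKernel_pos hs _).le, heatKernel_mul_heatKernel hs ht,
        ENNReal.ofReal_mul (heatKernel_pos (by positivity) _).le]
    simp_rw [e2]
    have e3 : ∫⁻ z, ennHeatKernel (s * t / (s + t)) (z - (s + t)⁻¹ • (t • v + s • x)) = 1 :=
      lintegral_heatKernel_sub (by positivity) _
    rw [lintegral_const_mul' (ennHeatKernel (s + t) (x - v)) _ ENNReal.ofReal_ne_top, e3, mul_one]
  simp_rw [e] at h
  rw [weightHeat, weightHeat]
  exact (lintegral_congr fun y => mul_comm _ _).trans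
    (h.trans (lintegral_congr fun y => mul_comm _ _))

theorem IsModerateWeight.weightHeat {d : ℕ} {C : ℝ} {N : ℕ}
    {w : EuclideanSpace ℝ (Fin d) → ℝ≥0∞} (hw : IsModerateWeight C N w) (t : ℝ) :
    IsModerateWeight C N (weightHeat w t) := by
  refine ⟨measurable_weightHeat hw.measurable t, fun x y => ?_⟩
  have e : ∀ x, _root_.weightHeat w t x = ∫⁻ z, w (x - z) * ennHeatKernel t z := fun x => by
    rw [_root_.weightHeat, ← lintegral_sub_left_eq_self (fun z => w z * ennHeatKernel t (x - z)) x]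
    exact lintegral_congr fun z => by rw [sub_sub_cancel]
  rw [e, e, ← lintegral_const_mul' _ _ ENNReal.ofReal_ne_top]
  refine lintegral_mono fun z => ?_
  rw [← mul_assoc]
  gcongr
  simpa using hw.le_mul (x - z) (y - z)

theorem IsModerateWeight.comp_smul {d : ℕ} {C : ℝ} {N : ℕ}
    {w : EuclideanSpace ℝ (Fin d) → ℝ≥0∞} (hw : IsModerateWeight C N w) {r : ℝ} (hr0 : 0 ≤ r)
    (hr : r ≤ 1) : IsModerateWeight C N fun x => w (r • x) := by
  refine ⟨hw.measurable.comp (measurable_const_smul r), fun x y =>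
    (hw.le_mul (r • x) (r • y)).trans (mul_le_mul_left ?_ _)⟩
  rw [ENNReal.ofReal_mul' (by positivity), ENNReal.ofReal_mul' (by positivity)]
  gcongr
  rw [← smul_sub, norm_smul, Real.norm_of_nonneg hr0]
  exact mul_le_of_le_one_left (norm_nonneg _) hr

theorem heatKernel_sq_mul_smul {d : ℕ} {r t : ℝ} (hr : 0 < r) (ht : 0 < t)
    (z : EuclideanSpace ℝ (Fin d)) :
    heatKernel (r ^ 2 * t) (r • z) = (r ^ d)⁻¹ * heatKernel t z := by
  unfold heatKernel
  rw [show 4 * Real.pi * (r ^ 2 * t) = r ^ 2 * (4 * Real.pi * t) by ring,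
    Real.mul_rpow (by positivity) (by positivity), norm_smul, Real.norm_of_nonneg hr.le, mul_assoc]
  congr 1
  · rw [← Real.rpow_natCast r 2, ← Real.rpow_mul hr.le, ← Real.rpow_natCast r d,
      ← Real.rpow_neg hr.le]
    congr 1; push_cast; ring
  · congr 2; field_simp

theorem measureHeat_map_smul {d : ℕ} (μ : Measure (EuclideanSpace ℝ (Fin d))) {r t : ℝ}
    (hr : 0 < r) (ht : 0 < t) (x : EuclideanSpace ℝ (Fin d)) :
    measureHeat (μ.map (r • ·)) (r ^ 2 * t) (r • x) =
      ENNReal.ofReal (r ^ d)⁻¹ * measureHeat μ t x := by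
  rw [measureHeat, lintegral_map (measurable_ennHeatKernel_sub _ _) (measurable_const_smul r),
    measureHeat, ← lintegral_const_mul' _ _ ENNReal.ofReal_ne_top]
  refine lintegral_congr fun y => ?_
  rw [← smul_sub, ennHeatKernel, heatKernel_sq_mul_smul hr ht, ENNReal.ofReal_mul (by positivity),
    ennHeatKernel]

theorem lintegral_comp_smul_euclidean {d : ℕ} {f : EuclideanSpace ℝ (Fin d) → ℝ≥0∞}
    (hf : Measurable f) {r : ℝ} (hr : 0 < r) :
    ∫⁻ x, f (r • x) = ENNReal.ofReal (r ^ d)⁻¹ * ∫⁻ x, f x := by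
  rw [← lintegral_map (f := f) hf (measurable_const_smul r),
    Measure.map_addHaar_smul _ hr.ne', lintegral_smul_measure, finrank_euclideanSpace,
    Fintype.card_fin, abs_of_pos (by positivity), smul_eq_mul]

theorem weightHeat_comp_smul {d : ℕ} {w : EuclideanSpace ℝ (Fin d) → ℝ≥0∞} (hw : Measurable w)
    {r t : ℝ} (hr : 0 < r) (ht : 0 < t) (x : EuclideanSpace ℝ (Fin d)) :
    weightHeat (fun z => w (r⁻¹ • z)) (r ^ 2 * t) (r • x) = weightHeat w t x := by
  have hrd : ENNReal.ofReal (r ^ d)⁻¹ ≠ 0 := by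
    simp only [ne_eq, ENNReal.ofReal_eq_zero, not_le]; positivity
  have hm : Measurable fun y => w (r⁻¹ • y) * ennHeatKernel (r ^ 2 * t) (r • x - y) :=
    (hw.comp (measurable_const_smul _)).mul (measurable_ennHeatKernel_sub _ _)
  have h := lintegral_comp_smul_euclidean hm hr
  rw [← ENNReal.mul_right_inj hrd ENNReal.ofReal_ne_top]
  rw [weightHeat, ← h, weightHeat, ← lintegral_const_mul' _ _ ENNReal.ofReal_ne_top]
  refine lintegral_congr fun y => ?_
  rw [smul_smul, inv_mul_cancel₀ hr.ne', one_smul, ← smul_sub, ennHeatKernel,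
    heatKernel_sq_mul_smul hr ht, ENNReal.ofReal_mul (by positivity), ennHeatKernel]
  ring

theorem one_sub_mul_le_rpow {a t : ℝ} (ha : 0 ≤ a) (ht : 1 / 2 ≤ t) (ht1 : t ≤ 1) :
    1 - a * (1 - t) ≤ t ^ (a / 2) := by
  have ht0 : 0 < t := by linarith
  rw [Real.rpow_def_of_pos ht0]
  have h1 := Real.add_one_le_exp (Real.log t * (a / 2))
  have h2 := Real.one_sub_inv_le_log_of_pos ht0
  have h3 : -2 * (1 - t) ≤ 1 - t⁻¹ := by
    have : 1 - t⁻¹ = -(t⁻¹ * (1 - t)) := by field_simp; ring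
    rw [this]
    have h4 : t⁻¹ ≤ 2 := by rw [inv_le_comm₀ ht0 two_pos]; linarith
    nlinarith
  nlinarith

/-- The improved inequality for times `t ∈ [1/2, 1)`, given a lower bound for the averaged spread. -/
theorem lintegral_measureHeat_rpow_mul_weightHeat_le_of_half_le {d : ℕ}
    {μ : Measure (EuclideanSpace ℝ (Fin d))} [SFinite μ] {p c₀ : ℝ} (hp : 1 < p) (hc₀ : 0 < c₀)
    (hμ : ∀ x, measureHeat μ 1 x ≠ ∞) {w : EuclideanSpace ℝ (Fin d) → ℝ≥0∞} (hw : Measurable w)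
    (hsp : ∫⁻ x, measureHeat μ 1 x ^ p * w x ≠ ∞ →
        ENNReal.ofReal c₀ * ∫⁻ x, measureHeat μ 1 x ^ p * w x ≤
          ∫⁻ x, spread (p / 16) μ x * measureHeat μ 1 x ^ (p - 2) * w x)
    {t : ℝ} (ht : 1 / 2 ≤ t) (ht1 : t < 1) :
    ∫⁻ x, measureHeat μ t x ^ p * weightHeat w ((1 - t) / p) x ≤
      ENNReal.ofReal (t ^ (-((d : ℝ) / 2) * (p - 1) + min 1 (p - 1) * c₀ / 2)) *
        ∫⁻ x, measureHeat μ 1 x ^ p * w x := by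
  have ht0 : 0 < t := by linarith
  set I := ∫⁻ x, measureHeat μ 1 x ^ p * w x with hI
  rcases eq_or_ne I ∞ with hIt | hIt
  · rw [hIt, ENNReal.mul_top]
    · exact le_top
    · simp only [ne_eq, ENNReal.ofReal_eq_zero, not_le]; positivity
  have hu := measurable_measureHeat μ 1
  set κ := min 1 (p - 1) with hκ
  have hκ0 : 0 < κ := lt_min one_pos (by linarith)
  set A := t ^ (-((d : ℝ) / 2) * (p - 1)) with hA
  have hA0 : 0 < A := by positivity
  set X := ∫⁻ x, measureHeat μ t x ^ p * weightHeat w ((1 - t) / p) x with hX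
  set D := ∫⁻ x, spread (p / 16) μ x * measureHeat μ 1 x ^ (p - 2) * w x with hD
  have hmain : X + ENNReal.ofReal (A * (κ * (1 - t))) * D ≤ ENNReal.ofReal A * I := by
    rw [hX, lintegral_mul_weightHeat ((measurable_measureHeat μ t).pow_const p) hw, hD, hI,
      ← lintegral_const_mul' _ _ ENNReal.ofReal_ne_top,
      ← lintegral_const_mul' _ _ ENNReal.ofReal_ne_top, ← lintegral_add_right]
    · refine lintegral_mono fun x => ?_
      have h := lintegral_measureHeat_rpow_add_le μ hp ht0 ht1 x (hμ x)
      rw [← mul_assoc (ENNReal.ofReal A) _ (w x)]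
      refine le_trans (le_of_eq ?_) (mul_le_mul_left h (w x))
      rw [ENNReal.ofReal_mul hA0.le]
      ring
    · exact ((((measurable_spread _ μ).mul (hu.pow_const _)).mul hw).const_mul _)
  have h2 : X + ENNReal.ofReal (A * (κ * c₀ * (1 - t))) * I ≤ ENNReal.ofReal A * I := by
    refine le_trans (add_le_add_right ?_ X) hmain
    rw [show A * (κ * c₀ * (1 - t)) = A * (κ * (1 - t)) * c₀ by ring,
      ENNReal.ofReal_mul (mul_nonneg hA0.le (mul_nonneg hκ0.le (by linarith))), mul_assoc]
    gcongr
    exact hsp hIt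
  have h3 := ENNReal.le_sub_of_add_le_right
    (ENNReal.mul_ne_top ENNReal.ofReal_ne_top hIt) h2
  refine h3.trans ?_
  rw [← ENNReal.sub_mul (fun _ _ => hIt), ← ENNReal.ofReal_sub _
    (mul_nonneg hA0.le (mul_nonneg (mul_pos hκ0 hc₀).le (by linarith)))]
  gcongr
  rw [Real.rpow_add ht0, ← hA]
  have := one_sub_mul_le_rpow (mul_pos hκ0 hc₀).le ht ht1.le
  nlinarith

/-- The improved inequality for all times, by induction on `n` for `t ≥ 2 ^ (-n - 1)`. If `t < 1/2`,
the inequality at time `1/2` is followed by the one at time `2t` for the measure and the weight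
`H[w](·, 1 / (2p))` dilated by `√2`. -/
theorem exists_lintegral_measureHeat_rpow_mul_weightHeat_le {d : ℕ}
    {M : Set (RealTemperedDistribution d)}
    (hM : IsInvariantConeOfMeasures M) (hδ : RealTemperedDistribution.dirac 0 ∉ M)
    (C : ℝ) (N : ℕ) {p : ℝ} (hp : 1 < p) :
    ∃ a : ℝ, 0 < a ∧ ∀ T ∈ M, ∀ μ, T.IsRepresentedBy μ → ∀ w, IsModerateWeight C N w →
      ∀ t : ℝ, 0 < t → t < 1 →
        ∫⁻ x, measureHeat μ t x ^ p * weightHeat w ((1 - t) / p) x ≤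
          ENNReal.ofReal (t ^ (-((d : ℝ) / 2) * (p - 1) + a)) *
            ∫⁻ x, measureHeat μ 1 x ^ p * w x := by
  have hp0 : 0 < p := by linarith
  obtain ⟨c₀, hc₀, hlow⟩ := exists_mul_lintegral_le_lintegral_spread hM hδ C N hp
    (show 0 < p / 16 by positivity)
  have hκ0 : 0 < min 1 (p - 1) := lt_min one_pos (by linarith)
  refine ⟨min 1 (p - 1) * c₀ / 2, by positivity, ?_⟩
  set e := -((d : ℝ) / 2) * (p - 1) + min 1 (p - 1) * c₀ / 2 with he
  have hstep : ∀ T ∈ M, ∀ μ, T.IsRepresentedBy μ → ∀ w, IsModerateWeight C N w →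
      ∀ t : ℝ, 1 / 2 ≤ t → t < 1 →
        ∫⁻ x, measureHeat μ t x ^ p * weightHeat w ((1 - t) / p) x ≤
          ENNReal.ofReal (t ^ e) * ∫⁻ x, measureHeat μ 1 x ^ p * w x :=
    fun T hT μ hμ w hw t ht ht1 => by
      have := hμ.sFinite
      exact lintegral_measureHeat_rpow_mul_weightHeat_le_of_half_le hp hc₀
        (hμ.measureHeat_ne_top one_pos) hw.measurable (hlow T hT μ hμ w hw) ht ht1
  have hiter : ∀ n : ℕ, ∀ T ∈ M, ∀ μ, T.IsRepresentedBy μ → ∀ w, IsModerateWeight C N w →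
      ∀ t : ℝ, (1 / 2) ^ (n + 1) ≤ t → t < 1 →
        ∫⁻ x, measureHeat μ t x ^ p * weightHeat w ((1 - t) / p) x ≤
          ENNReal.ofReal (t ^ e) * ∫⁻ x, measureHeat μ 1 x ^ p * w x := by
    intro n
    induction n with
    | zero => simpa using hstep
    | succ n ih =>
      intro T hT μ hμ w hw t ht ht1
      have ht0 : 0 < t := lt_of_lt_of_le (by positivity) ht
      rcases le_or_gt (1 / 2) t with h2 | h2
      · exact hstep T hT μ hμ w hw t h2 ht1
      have hμs := hμ.sFinite
      have hhalf := hstep T hT μ hμ w hw (1 / 2) le_rfl (by norm_num)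
      set s : ℝ := (1 - 1 / 2) / p with hs
      have hs0 : 0 < s := by rw [hs]; apply div_pos _ hp0; norm_num
      have hw1 := hw.weightHeat s
      -- rescale so that the time `1 / 2` becomes the time `1`
      set r : ℝ := Real.sqrt 2 with hr
      have hr0 : 0 < r := by positivity
      have hr2 : r ^ 2 = 2 := Real.sq_sqrt zero_le_two
      have hr1 : r⁻¹ ≤ 1 := inv_le_one_of_one_le₀ (by rw [hr, Real.one_le_sqrt]; norm_num)
      have hT' := hM.dilate_mem T hT r hr0
      have hμ' := hμ.dilate hr0.ne'
      have hμs' := hμ'.sFinite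
      have hw' := hw1.comp_smul (inv_nonneg.2 hr0.le) hr1
      have h := ih _ hT' _ hμ' _ hw' (2 * t) (by rw [pow_succ] at ht; linarith) (by linarith)
      set B := ENNReal.ofReal (r ^ d)⁻¹ with hB
      have hB0 : B ≠ 0 := by rw [hB]; simp only [ne_eq, ENNReal.ofReal_eq_zero, not_le]; positivity
      have hBt : B ≠ ∞ := ENNReal.ofReal_ne_top
      have hE : B ^ p ≠ 0 := by simp [ENNReal.rpow_eq_zero_iff, hB0, hBt]
      have hEt : B ^ p ≠ ∞ := ENNReal.rpow_ne_top_of_nonneg hp0.le hBt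
      have hU : ∀ τ, 0 < τ → ∀ x, measureHeat (μ.map (r • ·)) (2 * τ) (r • x) =
          B * measureHeat μ τ x := fun τ hτ x => by
        rw [← hr2]; exact measureHeat_map_smul μ hr0 hτ x
      have hlhs : B * ∫⁻ x, measureHeat (μ.map (r • ·)) (2 * t) x ^ p *
          weightHeat (fun z => weightHeat w s (r⁻¹ • z)) ((1 - 2 * t) / p) x =
          B ^ p * ∫⁻ x, measureHeat μ t x ^ p * weightHeat w ((1 - t) / p) x := by
        have hm : Measurable fun x => measureHeat (μ.map (r • ·)) (2 * t) x ^ p *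
            weightHeat (fun z => weightHeat w s (r⁻¹ • z)) ((1 - 2 * t) / p) x :=
          ((measurable_measureHeat _ _).pow_const p).mul (measurable_weightHeat hw'.measurable _)
        rw [hB, ← lintegral_comp_smul_euclidean hm hr0, ← hB, ← lintegral_const_mul' _ _ hEt]
        refine lintegral_congr fun x => ?_
        rw [hU t ht0, ENNReal.mul_rpow_of_nonneg _ _ hp0.le, mul_assoc]
        congr 2
        have hτ : 0 < (1 - 2 * t) / (2 * p) := div_pos (by linarith) (by positivity)
        have e1 : (1 - 2 * t) / p = r ^ 2 * ((1 - 2 * t) / (2 * p)) := by rw [hr2]; field_simp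
        rw [e1, weightHeat_comp_smul hw1.measurable hr0 hτ, weightHeat_weightHeat hw.measurable hs0 hτ]
        congr 1
        rw [hs]; field_simp; ring
      have hrhs : B * ∫⁻ x, measureHeat (μ.map (r • ·)) 1 x ^ p * weightHeat w s (r⁻¹ • x) =
          B ^ p * ∫⁻ x, measureHeat μ (1 / 2) x ^ p * weightHeat w s x := by
        have hm : Measurable fun x => measureHeat (μ.map (r • ·)) 1 x ^ p *
            weightHeat w s (r⁻¹ • x) :=
          ((measurable_measureHeat _ _).pow_const p).mul hw'.measurable
        rw [hB, ← lintegral_comp_smul_euclidean hm hr0, ← hB, ← lintegral_const_mul' _ _ hEt]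
        refine lintegral_congr fun x => ?_
        have e1 := hU (1 / 2) (by norm_num) x
        rw [show (2 : ℝ) * (1 / 2) = 1 by norm_num] at e1
        rw [e1, ENNReal.mul_rpow_of_nonneg _ _ hp0.le, mul_assoc, smul_smul,
          inv_mul_cancel₀ hr0.ne', one_smul]
      have h4 := mul_le_mul_right h B
      rw [hlhs, mul_left_comm, hrhs, mul_left_comm] at h4
      have h5 := (ENNReal.mul_le_mul_iff_right hE hEt).1 h4
      refine h5.trans ((mul_le_mul_right hhalf _).trans_eq ?_)
      rw [← mul_assoc, ← ENNReal.ofReal_mul (by positivity),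
        ← Real.mul_rpow (by positivity) (by positivity)]
      congr 3; ring
  intro T hT μ hμ w hw t ht0 ht1
  obtain ⟨n, hn⟩ := exists_pow_lt_of_lt_one ht0 (show (1 / 2 : ℝ) < 1 by norm_num)
  refine hiter n T hT μ hμ w hw t (le_trans ?_ hn.le) ht1
  exact pow_le_pow_of_le_one (by norm_num) (by norm_num) (by omega)

theorem isModerateWeight_of_smoothnessFunction_le {d : ℕ} {G : EuclideanSpace ℝ (Fin d) → ℝ}
    (hG : Continuous G) (hpos : ∀ x, 0 < G x) {C θ : ℝ}
    (h : ∀ ζ : ℝ, 0 ≤ ζ → smoothnessFunction G ζ ≤ ENNReal.ofReal (C * (1 + |ζ|) ^ θ)) :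
    IsModerateWeight |C| ⌈θ⌉₊ fun x => ENNReal.ofReal (G x) := by
  refine ⟨hG.measurable.ennreal_ofReal, fun x y => ?_⟩
  have h1 : ENNReal.ofReal (G x / G y) ≤ smoothnessFunction G ‖x - y‖ :=
    le_iSup₂_of_le x y (le_iSup_of_le le_rfl le_rfl)
  have h2 := h1.trans (h _ (norm_nonneg _))
  calc ENNReal.ofReal (G x) = ENNReal.ofReal (G x / G y) * ENNReal.ofReal (G y) := by
        rw [← ENNReal.ofReal_mul (div_pos (hpos x) (hpos y)).le, div_mul_cancel₀ _ (hpos y).ne']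
    _ ≤ _ := by
        refine mul_le_mul_left (h2.trans (ENNReal.ofReal_le_ofReal ?_)) _
        rw [abs_of_nonneg (norm_nonneg (x - y)), ← Real.rpow_natCast]
        gcongr
        · exact le_abs_self C
        · linarith [norm_nonneg (x - y)]
        · exact Nat.le_ceil θ

/-- No integrability is needed: the integral of a non-integrable function is `0`. -/
theorem ofReal_integral_le_lintegral_ofReal {α : Type*} [MeasurableSpace α] {m : Measure α}
    {f : α → ℝ} (hf : ∀ x, 0 ≤ f x) :
    ENNReal.ofReal (∫ x, f x ∂m) ≤ ∫⁻ x, ENNReal.ofReal (f x) ∂m := by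
  by_cases h : Integrable f m
  · rw [ofReal_integral_eq_lintegral_ofReal h (.of_forall hf)]
  · rw [integral_undef h]; simp

theorem weightedLpNorm_heat {d : ℕ} {T : RealTemperedDistribution d}
    {μ : Measure (EuclideanSpace ℝ (Fin d))} (hT : T.IsNonneg) (h : T.IsRepresentedBy μ) {p t : ℝ}
    (hp : 0 < p) (ht : 0 < t) (w : EuclideanSpace ℝ (Fin d) → ℝ) :
    weightedLpNorm p w (fun x => T.heat x t) =
      (∫⁻ x, measureHeat μ t x ^ p * ENNReal.ofReal (w x)) ^ (1 / p) := by
  unfold weightedLpNorm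
  congr 1
  refine lintegral_congr fun x => ?_
  have h0 : 0 ≤ T.heat x t := hT _ fun y => by
    rw [schwartzHeatKernel_apply t ht]; exact (heatKernel_pos ht _).le
  rw [abs_of_nonneg h0, ENNReal.ofReal_mul (by positivity),
    ← ENNReal.ofReal_rpow_of_nonneg h0 hp.le, h.ofReal_heat ht]

theorem theorem3p1 (d : ℕ) (M : Set (RealTemperedDistribution d))
    (hM : IsInvariantConeOfMeasures M) (hδ : RealTemperedDistribution.dirac 0 ∉ M)
    (C θ p : ℝ) (hp : 1 < p) :
    ∃ δ : ℝ, 0 < δ ∧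
      ∀ G : EuclideanSpace ℝ (Fin d) → ℝ, Continuous G → (∀ x, 0 < G x) →
        (∀ ζ : ℝ, 0 ≤ ζ → smoothnessFunction G ζ ≤ ENNReal.ofReal (C * (1 + |ζ|) ^ θ)) →
        ∀ μ ∈ M, weightedLpNorm p G (fun x => μ.heat x 1) ≠ ∞ →
          ∀ t : ℝ, 0 < t → t ≤ 1 →
            weightedLpNorm p (fun x => heatExtension G x ((1 - t) / p)) (fun x => μ.heat x t)
              ≤ ENNReal.ofReal (t ^ (-((d : ℝ) / 2) * ((p - 1) / p) + δ))
                * weightedLpNorm p G (fun x => μ.heat x 1) := by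
  have hp0 : 0 < p := by linarith
  obtain ⟨a, ha, H⟩ := exists_lintegral_measureHeat_rpow_mul_weightHeat_le hM hδ |C| ⌈θ⌉₊ hp
  refine ⟨a / p, by positivity, fun G hG hpos hs T hT _ t ht ht1 => ?_⟩
  have hTn := hM.nonneg T hT
  obtain ⟨μ, hμ⟩ := hTn.exists_isRepresentedBy
  rw [weightedLpNorm_heat hTn hμ hp0 ht, weightedLpNorm_heat hTn hμ hp0 one_pos]
  rcases ht1.eq_or_lt with rfl | ht1
  · simp [heatExtension]
  have h := H T hT μ hμ _ (isModerateWeight_of_smoothnessFunction_le hG hpos hs) t ht ht1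
  have hle : ∀ x, ENNReal.ofReal (heatExtension G x ((1 - t) / p)) ≤
      weightHeat (fun x => ENNReal.ofReal (G x)) ((1 - t) / p) x := fun x => by
    have hτ : 0 < (1 - t) / p := div_pos (by linarith) hp0
    rw [heatExtension, if_neg hτ.ne']
    refine (ofReal_integral_le_lintegral_ofReal fun y =>
      mul_nonneg (hpos y).le (heatKernel_pos hτ _).le).trans_eq ?_
    exact lintegral_congr fun y => ENNReal.ofReal_mul (hpos y).le
  calc _ ≤ (∫⁻ x, measureHeat μ t x ^ p *
        weightHeat (fun x => ENNReal.ofReal (G x)) ((1 - t) / p) x) ^ (1 / p) := by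
        gcongr with x
        exact hle x
    _ ≤ _ := ENNReal.rpow_le_rpow h (by positivity)
    _ = _ := by
        rw [ENNReal.mul_rpow_of_nonneg _ _ (by positivity), ENNReal.ofReal_rpow_of_pos (by positivity),
          ← Real.rpow_mul ht.le]
        congr 3
        field_simp
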